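/- Let $n\ge 0$ and let $\mu$ be the standard Gaussian measure on $\mathbb{R}^n$ with Euclidean norm $|\cdot|$. Let $D:L^2(\mathbb{R}^n,\mu)\to L^2(\mathbb{R}^n,\mu;\mathbb{R}^n)$ be the closure of the gradient $f\mapsto \nabla f$ defined on the infinitely differentiable functions $f:\mathbb{R}^n\to\mathbb{R}$ that are bounded together with all their derivatives, and let $I=D^*:L^2(\mathbb{R}^n,\mu;\mathbb{R}^n)\to L^2(\mathbb{R}^n,\mu)$ be its (unbounded) adjoint. For Borel probability measures $\nu_0,\nu_1$ on $\mathbb{R}^n$ let $$W_1(\nu_0,\nu_1)=\inf_{\pi}\int_{\mathbb{R}^n\times\mathbb{R}^n}|x_1-x_2|\,\pi(dx_1,dx_2),$$ where the infimum is over all Borel probability measures $\pi$ on $\mathbb{R}^n\times\mathbb{R}^n$ with marginals $\nu_0$ and $\nu_1$. Suppose that the signed measure $\nu_1-\nu_0$ is absolutely continuous with respect to $\mu$ and that $\frac{d(\nu_1-\nu_0)}{d\mu}\in L^2(\mathbb{R}^n,\mu)$. Then $$W_1(\nu_0,\nu_1)=\inf\Big\{\int_{\mathbb{R}^n}|u(x)|\,\mu(dx)\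 :\ u\in \operatorname{dom}(I)\subset L^2(\mathbb{R}^n,\mu;\mathbb{R}^n),\ Iu=\frac{d(\nu_1-\nu_0)}{d\mu}\Big\}.$$ -/

import Mathlib

open MeasureTheory ProbabilityTheory
open scoped ENNReal ContDiff LinearPMap

namespace GaussianKR

/-- `π` is a coupling of `ν₀` and `ν₁`: a Borel measure on the product with these marginals. -/
def IsCoupling {X : Type*} [MeasurableSpace X] (π : Measure (X × X)) (ν₀ ν₁ : Measure X) : Prop :=
  π.map Prod.fst = ν₀ ∧ π.map Prod.snd = ν₁

/-- The Kantorovich-Rubinstein distance: the infimum of the transport cost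
`∫ |x₁ - x₂| π(dx₁, dx₂)` over all couplings, as a number in `[0, ∞]`. -/
noncomputable def W₁ {X : Type*} [PseudoEMetricSpace X] [MeasurableSpace X]
    (ν₀ ν₁ : Measure X) : ℝ≥0∞ :=
  ⨅ (π : Measure (X × X)) (_ : IsCoupling π ν₀ ν₁), ∫⁻ p, edist p.1 p.2 ∂π

/-- The space `ℝⁿ` with the Euclidean norm. -/
abbrev R (n : ℕ) : Type := EuclideanSpace ℝ (Fin n)

/-- The standard Gaussian measure on `ℝⁿ`. -/
noncomputable abbrev γ (n : ℕ) : Measure (R n) := stdGaussian (R n)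

/-- Smooth functions on `ℝⁿ` that are bounded together with all their derivatives. -/
structure IsFC {n : ℕ} (f : R n → ℝ) : Prop where
  smooth : ContDiff ℝ ∞ f
  bounded : ∀ k : ℕ, ∃ C : ℝ, ∀ x, ‖iteratedFDeriv ℝ k f x‖ ≤ C

theorem IsFC.zero {n : ℕ} : IsFC (fun _ : R n => (0 : ℝ)) :=
  ⟨contDiff_const, fun k => ⟨0, fun x => by simp⟩⟩

theorem IsFC.add {n : ℕ} {f g : R n → ℝ} (hf : IsFC f) (hg : IsFC g) : IsFC (f + g) := by
  refine ⟨hf.smooth.add hg.smooth, fun k => ?_⟩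
  obtain ⟨C, hC⟩ := hf.bounded k
  obtain ⟨C', hC'⟩ := hg.bounded k
  refine ⟨C + C', fun x => ?_⟩
  rw [iteratedFDeriv_add_apply (hf.smooth.contDiffAt.of_le (by exact_mod_cast le_top))
    (hg.smooth.contDiffAt.of_le (by exact_mod_cast le_top))]
  exact (norm_add_le _ _).trans (add_le_add (hC x) (hC' x))

theorem IsFC.smul {n : ℕ} {f : R n → ℝ} (c : ℝ) (hf : IsFC f) : IsFC (c • f) := by
  refine ⟨hf.smooth.const_smul c, fun k => ?_⟩
  obtain ⟨C, hC⟩ := hf.bounded k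
  refine ⟨‖c‖ * C, fun x => ?_⟩
  rw [iteratedFDeriv_const_smul_apply (hf.smooth.contDiffAt.of_le (by exact_mod_cast le_top)),
    norm_smul]
  exact mul_le_mul_of_nonneg_left (hC x) (norm_nonneg _)

theorem IsFC.differentiable {n : ℕ} {f : R n → ℝ} (hf : IsFC f) : Differentiable ℝ f :=
  hf.smooth.differentiable (by simp)

theorem gradient_add' {n : ℕ} {f g : R n → ℝ} (hf : IsFC f) (hg : IsFC g) (x : R n) :
    gradient (f + g) x = gradient f x + gradient g x := by
  simp only [gradient]
  rw [fderiv_add (hf.differentiable x) (hg.differentiable x), map_add]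

theorem gradient_smul' {n : ℕ} {f : R n → ℝ} (c : ℝ) (hf : IsFC f) (x : R n) :
    gradient (c • f) x = c • gradient f x := by
  simp only [gradient]
  rw [fderiv_const_smul (hf.differentiable x)]
  simp

/-- The graph in `L²(γ) × L²(γ; ℝⁿ)` of the derivative `f ↦ Df` of smooth bounded functions. -/
noncomputable def derivGraph (n : ℕ) : Submodule ℝ (Lp ℝ 2 (γ n) × Lp (R n) 2 (γ n)) where
  carrier := {p | ∃ f : R n → ℝ, IsFC f ∧ p.1 =ᵐ[γ n] f ∧ p.2 =ᵐ[γ n] gradient f}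
  zero_mem' := by
    refine ⟨fun _ => 0, IsFC.zero, Lp.coeFn_zero _ _ _, ?_⟩
    filter_upwards [Lp.coeFn_zero (R n) 2 (γ n)] with x hx
    simp only [Prod.snd_zero, hx, Pi.zero_apply, gradient, fderiv_fun_const, map_zero]
  add_mem' := by
    rintro p q ⟨f, hf, h1, h2⟩ ⟨g, hg, h3, h4⟩
    refine ⟨f + g, hf.add hg, ?_, ?_⟩
    · filter_upwards [Lp.coeFn_add p.1 q.1, h1, h3] with x hx h h'
      simp only [Prod.fst_add, hx, Pi.add_apply, h, h']
    · filter_upwards [Lp.coeFn_add p.2 q.2, h2, h4] with x hx h h'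
      simp only [Prod.snd_add, hx, Pi.add_apply, h, h', gradient_add' hf hg]
  smul_mem' := by
    rintro c p ⟨f, hf, h1, h2⟩
    refine ⟨c • f, hf.smul c, ?_, ?_⟩
    · filter_upwards [Lp.coeFn_smul c p.1, h1] with x hx h
      simp only [Prod.smul_fst, hx, Pi.smul_apply, h]
    · filter_upwards [Lp.coeFn_smul c p.2, h2] with x hx h
      simp only [Prod.smul_snd, hx, Pi.smul_apply, h, gradient_smul' c hf]

/-- The derivative on (classes of) smooth bounded functions, as an unbounded operator. -/
noncomputable def D₀ (n : ℕ) : Lp ℝ 2 (γ n) →ₗ.[ℝ] Lp (R n) 2 (γ n) :=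
  (derivGraph n).toLinearPMap

/-- The stochastic derivative `D : L²(γ) → L²(γ; ℝⁿ)`: the closure of the derivative on smooth
bounded functions. -/
noncomputable def D (n : ℕ) : Lp ℝ 2 (γ n) →ₗ.[ℝ] Lp (R n) 2 (γ n) :=
  (D₀ n).closure

/-- The extended stochastic integral (divergence) `I = D*`, the adjoint of the stochastic
derivative. -/
noncomputable def I (n : ℕ) : Lp (R n) 2 (γ n) →ₗ.[ℝ] Lp ℝ 2 (γ n) :=
  (D n)†

/-! Sanity facts: `D₀` is a well-defined, densely defined operator, and `I` is the operator
given by the integration by parts formula. -/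

instance isOpenPosMeasure_gaussian (n : ℕ) : (γ n).IsOpenPosMeasure := by
  rw [γ, ← map_pi_eq_stdGaussian]
  have : (gaussianReal 0 1).IsOpenPosMeasure :=
    (gaussianReal_absolutelyContinuous' 0 (one_ne_zero)).isOpenPosMeasure
  exact (PiLp.continuous_toLp 2 _).isOpenPosMeasure_map (WithLp.toLp_surjective 2)

theorem derivGraph_single_valued (n : ℕ) (p : Lp ℝ 2 (γ n) × Lp (R n) 2 (γ n))
    (hp : p ∈ derivGraph n) (h0 : p.1 = 0) : p.2 = 0 := by
  obtain ⟨f, hf, h1, h2⟩ := hp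
  have hz : f = fun _ => 0 := by
    refine (hf.smooth.continuous).ae_eq_iff_eq (γ n) continuous_const |>.1 ?_
    rw [h0] at h1
    exact h1.symm.trans (Lp.coeFn_zero _ _ _)
  refine Lp.ext (h2.trans ?_)
  filter_upwards [Lp.coeFn_zero (R n) 2 (γ n)] with x hx
  rw [hx]
  simp [hz, gradient]

theorem D₀_graph (n : ℕ) : (D₀ n).graph = derivGraph n :=
  Submodule.toLinearPMap_graph_eq _ fun p hp h0 => derivGraph_single_valued n p hp h0

theorem IsFC.memLp {n : ℕ} {f : R n → ℝ} (hf : IsFC f) : MemLp f 2 (γ n) := by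
  obtain ⟨C, hC⟩ := hf.bounded 0
  exact MemLp.of_bound hf.smooth.continuous.aestronglyMeasurable C
    (Filter.Eventually.of_forall fun x => by simpa using hC x)

theorem IsFC.memLp_gradient {n : ℕ} {f : R n → ℝ} (hf : IsFC f) : MemLp (gradient f) 2 (γ n) := by
  obtain ⟨C, hC⟩ := hf.bounded 1
  have hc : Continuous (gradient f) :=
    (InnerProductSpace.toDual ℝ (R n)).symm.continuous.comp (hf.smooth.continuous_fderiv (by simp))
  refine MemLp.of_bound hc.aestronglyMeasurable C (Filter.Eventually.of_forall fun x => ?_)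
  have := hC x
  rw [norm_iteratedFDeriv_one] at this
  simpa [gradient] using this

theorem mem_derivGraph {n : ℕ} {f : R n → ℝ} (hf : IsFC f) :
    (hf.memLp.toLp f, hf.memLp_gradient.toLp (gradient f)) ∈ derivGraph n :=
  ⟨f, hf, hf.memLp.coeFn_toLp, hf.memLp_gradient.coeFn_toLp⟩

theorem isFC_of_hasCompactSupport {n : ℕ} {f : R n → ℝ} (hf : ContDiff ℝ ∞ f)
    (hc : HasCompactSupport f) : IsFC f :=
  ⟨hf, fun k => (hf.continuous_iteratedFDeriv (by exact_mod_cast le_top)).bounded_above_of_compact_support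
    (hc.iteratedFDeriv k)⟩

theorem dense_D₀ (n : ℕ) : Dense ((D₀ n).domain : Set (Lp ℝ 2 (γ n))) := by
  refine (Lp.dense_hasCompactSupport_contDiff (μ := γ n) (F := ℝ) (p := 2) (by simp)).mono ?_
  rintro f ⟨g, hfg, hc, hg⟩
  have hg' := isFC_of_hasCompactSupport hg hc
  have h := mem_derivGraph hg'
  rw [← D₀_graph] at h
  have := LinearPMap.mem_domain_of_mem_graph h
  rwa [show hg'.memLp.toLp g = f from Lp.ext (hg'.memLp.coeFn_toLp.trans hfg.symm)] at this

theorem dense_D (n : ℕ) : Dense ((D n).domain : Set (Lp ℝ 2 (γ n))) :=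
  (dense_D₀ n).mono (D₀ n).le_closure.1

theorem mem_I_graph_iff (n : ℕ) (u : Lp (R n) 2 (γ n)) (a : Lp ℝ 2 (γ n)) :
    (u, a) ∈ (I n).graph ↔
      ∀ f : R n → ℝ, IsFC f →
        ∫ x, inner ℝ (u x) (gradient f x) ∂(γ n) = ∫ x, a x * f x ∂(γ n) := by
  have key : (u, a) ∈ (I n).graph ↔
      ∀ p ∈ derivGraph n, inner ℝ p.2 u - inner ℝ p.1 a = 0 := by
    rw [I, LinearPMap.adjoint_graph_eq_graph_adjoint (dense_D n), Submodule.mem_adjoint_iff]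
    constructor
    · intro h p hp
      exact h p.1 p.2 (LinearPMap.le_graph_of_le (D₀ n).le_closure (by rwa [D₀_graph]))
    · intro h b c hbc
      by_cases hcl : (D₀ n).IsClosable
      · rw [D, ← hcl.graph_closure_eq_closure_graph, D₀_graph] at hbc
        have hclosed : IsClosed {p : Lp ℝ 2 (γ n) × Lp (R n) 2 (γ n) |
            inner ℝ p.2 u - inner ℝ p.1 a = 0} :=
          isClosed_eq (by fun_prop) continuous_const
        exact closure_minimal (fun p hp => h p hp) hclosed hbc
      · rw [D, LinearPMap.closure_def' hcl, D₀_graph] at hbc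
        exact h _ hbc
  rw [key]
  have aux : ∀ (p : Lp ℝ 2 (γ n) × Lp (R n) 2 (γ n)) (f : R n → ℝ), p.1 =ᵐ[γ n] f →
      p.2 =ᵐ[γ n] gradient f → (inner ℝ p.2 u - inner ℝ p.1 a = 0 ↔
        ∫ x, inner ℝ (u x) (gradient f x) ∂(γ n) = ∫ x, a x * f x ∂(γ n)) := by
    intro p f h1 h2
    rw [L2.inner_def, L2.inner_def, sub_eq_zero]
    refine Eq.congr (integral_congr_ae ?_) (integral_congr_ae ?_)
    · filter_upwards [h2] with x hx
      rw [hx, real_inner_comm]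
    · filter_upwards [h1] with x hx
      simp [hx]
  constructor
  · intro h f hf
    exact (aux _ f hf.memLp.coeFn_toLp hf.memLp_gradient.coeFn_toLp).1 (h _ (mem_derivGraph hf))
  · rintro h p ⟨f, hf, h1, h2⟩
    exact (aux p f h1 h2).2 (h f hf)

end GaussianKR

/-! The theorem is Kantorovich–Rubinstein duality combined with its analogue for fluxes. Write `α`
for the density of `ν₁ - ν₀`. Both sides are equal to the supremum of `∫ f α dγ` over `1`-Lipschitz
functions `f`.

For the transport cost, the hard inequality `W₁_le_of_density` is proved by discretization. The
common part of `ν₀` and `ν₁` stays where it is, so only the measures with densities `α⁻` and `α⁺`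
have to be transported, and these have first moments because `α` is square integrable
(`exists_common_part`). Simple functions close to the identity reduce the problem to finitely many
points, where it is separation of a compact convex set of plans from a half-line
(`exists_transport_plan_of_dual_le`); the resulting plan between the points is then spread over
the cells (`exists_isCoupling_of_plan`). The easy inequality is `ofReal_integral_mul_le_W₁`.

For fluxes, if `I u = α` then `∫ f α dγ = ∫ ⟪u, ∇f⟫ dγ ≤ ‖u‖₁` for smooth `f` with `|∇f| ≤ 1`, and
truncation and mollification extend this to every `1`-Lipschitz `f`
(`integral_mul_le_integral_norm`). Conversely, let `K` be the convex set of the functions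
`I u + t` with `‖u‖₁ < c` and `t` constant. It is open in `L²(γ)`, because `I` maps boundedly onto
the functions of mean zero (`exists_divergence_eq`); this is a Poincaré inequality, obtained by
joining two independent Gaussian points by a rotation. If `α ∉ K`, the Hahn–Banach theorem gives
`f ∈ L²(γ)` with `∫ f I u dγ ≤ ‖u‖₁` for all `u` and `∫ f α dγ = c`. Testing with `u = (η / ρ) v`,
where `ρ` is the Gaussian density and `η` a bump function, shows that the mollifications of `f` are
`1`-Lipschitz, and hence so is `f` (`exists_lipschitzWith_ae_eq`). Thus `c` is at most the supremum
above, so every larger `c` admits a field `u` with `I u = α` and `‖u‖₁ < c`. -/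

namespace GaussianKR

open scoped Convolution

/-! ### Finite transport duality -/

theorem lipschitzWith_inf'_dist {X ι : Type*} [PseudoMetricSpace X] (s : Finset ι)
    (hs : s.Nonempty) (x : ι → X) (φ : ι → ℝ) :
    LipschitzWith 1 fun y => s.inf' hs fun i => dist (x i) y + φ i := by
  refine LipschitzWith.of_le_add fun y z => ?_
  rw [← sub_le_iff_le_add]
  refine Finset.le_inf' _ _ fun i hi => ?_
  rw [sub_le_iff_le_add]
  refine (Finset.inf'_le _ hi).trans ?_
  linarith [dist_triangle (x i) z y, dist_comm y z]

/-- Duality for transport between finitely many points: a bound on the dual problem is attained by a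
transport plan. -/
theorem exists_transport_plan_of_dual_le {X ι : Type*} [PseudoMetricSpace X] [Fintype ι]
    (x : ι → X) (a b : ι → ℝ) (ha : ∀ i, 0 ≤ a i) (hb : ∀ i, 0 ≤ b i)
    (hab : ∑ i, a i = ∑ i, b i) (v : ℝ)
    (hv : ∀ f : X → ℝ, LipschitzWith 1 f → ∑ i, f (x i) * (b i - a i) ≤ v) :
    ∃ T : ι → ι → ℝ, (∀ i j, 0 ≤ T i j) ∧ (∀ i, ∑ j, T i j = a i) ∧ (∀ j, ∑ i, T i j = b j) ∧
      ∑ i, ∑ j, T i j * dist (x i) (x j) ≤ v := by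
  classical
  have hv0 : 0 ≤ v := by simpa using hv (fun _ => 0) (LipschitzWith.const' 0)
  obtain hm | hm := (Finset.sum_nonneg fun i _ => ha i : 0 ≤ ∑ i, a i).eq_or_lt
  · have ha0 : ∀ i, a i = 0 := fun i =>
      (Finset.sum_eq_zero_iff_of_nonneg fun i _ => ha i).1 hm.symm i (Finset.mem_univ i)
    have hb0 : ∀ i, b i = 0 := fun i =>
      (Finset.sum_eq_zero_iff_of_nonneg fun i _ => hb i).1 (hab ▸ hm.symm) i (Finset.mem_univ i)
    exact ⟨0, by simp, by simp [ha0], by simp [hb0], by simpa using hv0⟩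
  set m := ∑ i, a i with hmdef
  -- `L` sends a plan of mass one, scaled to mass `m`, to its marginals and its cost.
  let L : (ι × ι → ℝ) →ₗ[ℝ] (ι → ℝ) × (ι → ℝ) × ℝ :=
    { toFun := fun T => (fun i => m * ∑ j, T (i, j), fun j => m * ∑ i, T (i, j),
        m * ∑ p : ι × ι, T p * dist (x p.1) (x p.2))
      map_add' := fun S T => by
        simp only [Pi.add_apply, Finset.sum_add_distrib, mul_add, add_mul, Prod.mk_add_mk]
        rfl
      map_smul' := fun c T => by
        simp only [Pi.smul_apply, smul_eq_mul, mul_assoc, ← Finset.mul_sum, mul_left_comm m c,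
          RingHom.id_apply, Prod.smul_mk]
        rfl }
  by_contra! hT
  have hT' : ∀ T ∈ stdSimplex ℝ (ι × ι), (L T).1 = a → (L T).2.1 = b → v < (L T).2.2 := by
    intro T hTs h1 h2
    have := hT (fun i j => m * T (i, j)) (fun i j => mul_nonneg hm.le (hTs.1 _))
      (fun i => by rw [← congrFun h1 i, ← Finset.mul_sum]; rfl)
      (fun j => by rw [← congrFun h2 j, ← Finset.mul_sum]; rfl)
    refine this.trans_eq ?_
    change _ = m * ∑ p : ι × ι, T p * dist (x p.1) (x p.2)
    rw [Fintype.sum_prod_type, Finset.mul_sum]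
    simp only [Finset.mul_sum, mul_assoc]
  obtain ⟨F, u, w, hFu, huw, hwF⟩ := geometric_hahn_banach_compact_closed
    (s := L '' stdSimplex ℝ (ι × ι)) (t := ({a} : Set (ι → ℝ)) ×ˢ (({b} : Set (ι → ℝ)) ×ˢ Set.Iic v))
    ((convex_stdSimplex ℝ _).linear_image L)
    ((isCompact_stdSimplex ℝ _).image L.continuous_of_finiteDimensional)
    ((convex_singleton a).prod ((convex_singleton b).prod (convex_Iic v)))
    (isClosed_singleton.prod (isClosed_singleton.prod isClosed_Iic))
    (by
      rw [Set.disjoint_left]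
      rintro _ ⟨T, hTs, rfl⟩ ⟨h1, h2, h3⟩
      exact (hT' T hTs h1 h2).not_ge h3)
  set φ : ι → ℝ := fun i => F (Pi.single i 1, 0, 0) with hφ
  set ψ : ι → ℝ := fun j => F (0, Pi.single j 1, 0) with hψ
  set l : ℝ := - F (0, 0, 1) with hl
  have hF : ∀ a' b' r, F (a', b', r) = ∑ i, a' i * φ i + ∑ j, b' j * ψ j - r * l := by
    intro a' b' r
    have hsingle : ∀ i : ι, (fun j => if i = j then (1 : ℝ) else 0) = Pi.single i 1 := fun i => by
      ext j
      simp [Pi.single_apply, eq_comm]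
    have e1 : F (a', 0, 0) = ∑ i, a' i * φ i := by
      have := LinearMap.pi_apply_eq_sum_univ
        (F.toLinearMap ∘ₗ LinearMap.inl ℝ (ι → ℝ) ((ι → ℝ) × ℝ)) a'
      simp only [hsingle] at this
      exact this
    have e2 : F (0, b', 0) = ∑ i, b' i * ψ i := by
      have := LinearMap.pi_apply_eq_sum_univ
        (F.toLinearMap ∘ₗ LinearMap.inr ℝ (ι → ℝ) ((ι → ℝ) × ℝ) ∘ₗ LinearMap.inl ℝ (ι → ℝ) ℝ) b'
      simp only [hsingle] at this
      exact this
    have e3 : F (0, 0, r) = - (r * l) := by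
      have : ((0, 0, r) : (ι → ℝ) × (ι → ℝ) × ℝ) = r • (0, 0, 1) := by simp
      rw [this, map_smul, hl, smul_eq_mul, mul_neg, neg_neg]
    have : ((a', b', r) : (ι → ℝ) × (ι → ℝ) × ℝ) = (a', 0, 0) + (0, b', 0) + (0, 0, r) := by simp
    rw [this, map_add, map_add, e1, e2, e3]
    ring
  -- The product plan has the right marginals and costs more than `v`, which forces `0 < l`.
  have hprod : (fun p : ι × ι => m⁻¹ * m⁻¹ * (a p.1 * b p.2)) ∈ stdSimplex ℝ (ι × ι) := by
    refine ⟨fun p => mul_nonneg (by positivity) (mul_nonneg (ha _) (hb _)), ?_⟩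
    rw [← Finset.mul_sum, Fintype.sum_prod_type]
    simp only [← Finset.mul_sum, ← Finset.sum_mul, ← hab, ← hmdef]
    field_simp
  have hlpos : 0 < l := by
    have h1 : (L fun p : ι × ι => m⁻¹ * m⁻¹ * (a p.1 * b p.2)).1 = a := by
      funext i
      change m * ∑ j, m⁻¹ * m⁻¹ * (a i * b j) = a i
      simp only [← Finset.mul_sum, ← hab]
      field_simp
    have h2 : (L fun p : ι × ι => m⁻¹ * m⁻¹ * (a p.1 * b p.2)).2.1 = b := by
      funext j
      change m * ∑ i, m⁻¹ * m⁻¹ * (a i * b j) = b j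
      simp only [← Finset.mul_sum, ← Finset.sum_mul, ← hmdef]
      field_simp
    have h3 := hT' _ hprod h1 h2
    have h4 := hFu _ (Set.mem_image_of_mem L hprod)
    have h5 := hwF (a, b, v) ⟨rfl, rfl, Set.mem_Iic.2 le_rfl⟩
    rw [← Prod.mk.eta (p := L _), ← Prod.mk.eta (p := (L _).2), h1, h2, hF] at h4
    rw [hF] at h5
    by_contra! hneg
    nlinarith
  have hpair : ∀ i j, φ i + ψ j - dist (x i) (x j) * l < u / m := by
    intro i j
    have h := hFu _ (Set.mem_image_of_mem L (single_mem_stdSimplex ℝ (i, j)))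
    rw [lt_div_iff₀ hm]
    refine lt_of_eq_of_lt ?_ h
    change _ = F (fun i' => m * ∑ j', (Pi.single (i, j) 1 : ι × ι → ℝ) (i', j'),
      fun j' => m * ∑ i', (Pi.single (i, j) 1 : ι × ι → ℝ) (i', j'),
      m * ∑ p : ι × ι, (Pi.single (i, j) 1 : ι × ι → ℝ) p * dist (x p.1) (x p.2))
    rw [hF]
    have e1 : ∀ i', ∑ j', (Pi.single (i, j) 1 : ι × ι → ℝ) (i', j') = if i' = i then 1 else 0 := by
      intro i'
      by_cases h : i' = i <;> simp [Pi.single_apply, h]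
    have e2 : ∀ j', ∑ i', (Pi.single (i, j) 1 : ι × ι → ℝ) (i', j') = if j' = j then 1 else 0 := by
      intro j'
      by_cases h : j' = j <;> simp [Pi.single_apply, h]
    simp only [e1, e2]
    simp [Pi.single_apply]
    ring
  have hne : (Finset.univ : Finset ι).Nonempty := by
    rw [Finset.nonempty_iff_ne_empty]
    rintro h
    rw [hmdef, h, Finset.sum_empty] at hm
    exact lt_irrefl _ hm
  -- The potential: `-φ / l` made `1`-Lipschitz. By `hpair` it is still large where mass arrives.
  have hf := lipschitzWith_inf'_dist Finset.univ hne x (fun i => - (φ i / l))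
  set f : X → ℝ := fun y => Finset.univ.inf' hne fun i => dist (x i) y + -(φ i / l) with hfdef
  have h1 : ∀ i, f (x i) ≤ -(φ i / l) := fun i => by
    refine (Finset.inf'_le _ (Finset.mem_univ i)).trans ?_
    simp
  have h2 : ∀ j, (ψ j - u / m) / l ≤ f (x j) := fun j => by
    refine Finset.le_inf' _ _ fun i _ => ?_
    rw [div_le_iff₀ hlpos, add_mul, neg_mul, div_mul_cancel₀ _ hlpos.ne']
    linarith [hpair i j]
  have h3 : ∑ j, (ψ j - u / m) / l * b j - ∑ i, -(φ i / l) * a i ≤ v := by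
    refine le_trans ?_ (hv f hf)
    simp only [mul_sub, Finset.sum_sub_distrib]
    exact sub_le_sub (Finset.sum_le_sum fun j _ => mul_le_mul_of_nonneg_right (h2 j) (hb j))
      (Finset.sum_le_sum fun i _ => mul_le_mul_of_nonneg_right (h1 i) (ha i))
  have h4 : ∑ j, (ψ j - u / m) / l * b j - ∑ i, -(φ i / l) * a i =
      (∑ j, b j * ψ j - u + ∑ i, a i * φ i) / l := by
    have e1 : ∑ j, (ψ j - u / m) / l * b j = (∑ j, b j * ψ j - u) / l := by
      have : u = ∑ j, b j * (u / m) := by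
        rw [← Finset.sum_mul, ← hab]
        field_simp
      conv_rhs => rw [this, ← Finset.sum_sub_distrib, Finset.sum_div]
      exact Finset.sum_congr rfl fun j _ => by ring
    have e2 : ∑ i, -(φ i / l) * a i = - (∑ i, a i * φ i) / l := by
      rw [← Finset.sum_neg_distrib, Finset.sum_div]
      exact Finset.sum_congr rfl fun i _ => by ring
    rw [e1, e2]
    ring
  have h5 := hwF (a, b, v) ⟨rfl, rfl, Set.mem_Iic.2 le_rfl⟩
  rw [hF] at h5
  rw [h4, div_le_iff₀ hlpos] at h3
  linarith

/-! ### Kantorovich–Rubinstein duality for measures with a first moment -/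

theorem IsCoupling.lintegral_fst {X : Type*} [MeasurableSpace X] {π : Measure (X × X)}
    {ν₀ ν₁ : Measure X} (h : IsCoupling π ν₀ ν₁) {f : X → ℝ≥0∞} (hf : Measurable f) :
    ∫⁻ p, f p.1 ∂π = ∫⁻ x, f x ∂ν₀ := by
  rw [← h.1, lintegral_map hf measurable_fst]

theorem IsCoupling.lintegral_snd {X : Type*} [MeasurableSpace X] {π : Measure (X × X)}
    {ν₀ ν₁ : Measure X} (h : IsCoupling π ν₀ ν₁) {f : X → ℝ≥0∞} (hf : Measurable f) :
    ∫⁻ p, f p.2 ∂π = ∫⁻ x, f x ∂ν₁ := by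
  rw [← h.2, lintegral_map hf measurable_snd]

theorem W₁_le_of_isCoupling {X : Type*} [PseudoEMetricSpace X] [MeasurableSpace X]
    {ν₀ ν₁ : Measure X} {π : Measure (X × X)} (h : IsCoupling π ν₀ ν₁) :
    W₁ ν₀ ν₁ ≤ ∫⁻ p, edist p.1 p.2 ∂π :=
  iInf₂_le π h

theorem measureReal_smul_cond {X : Type*} [MeasurableSpace X] (a : Measure X)
    [IsFiniteMeasure a] (s : Set X) :
    ENNReal.ofReal (a.real s) • a[|s] = a.restrict s := by
  rw [ProbabilityTheory.cond, smul_smul, ofReal_measureReal]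
  by_cases h : a s = 0
  · simp [h, Measure.restrict_eq_zero.2 h]
  · rw [ENNReal.mul_inv_cancel h (measure_ne_top a s), one_smul]

theorem sum_restrict_preimage {X Y : Type*} [MeasurableSpace X] (a : Measure X)
    (q : SimpleFunc X Y) : ∑ i : q.range, a.restrict (q ⁻¹' {i.1}) = a := by
  ext s hs
  rw [Measure.finsetSum_apply, Finset.sum_coe_sort q.range fun i => a.restrict (q ⁻¹' {i}) s]
  simp only [Measure.restrict_apply hs]
  have := sum_measure_preimage_singleton (μ := a.restrict s) q.range (f := q)
    fun y _ => q.measurableSet_fiber y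
  simp only [Measure.restrict_apply (q.measurableSet_fiber _)] at this
  simp only [Set.inter_comm s, this]
  rw [Measure.restrict_apply (q.measurableSet_preimage _)]
  congr 1
  ext x
  simp

/-- A transport plan `T` between the values of a simple function `q` lifts to a coupling of the
original measures: the mass `T i j` is spread over the product of the cells `q = i` and `q = j`,
proportionally to `a ⊗ b`. -/
theorem exists_isCoupling_of_plan {X : Type*} [PseudoEMetricSpace X] [MeasurableSpace X]
    (a b : Measure X) [IsFiniteMeasure a] [IsFiniteMeasure b] (q : SimpleFunc X X)
    (T : q.range → q.range → ℝ) (hT : ∀ i j, 0 ≤ T i j)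
    (hTa : ∀ i, ∑ j, T i j = a.real (q ⁻¹' {i.1})) (hTb : ∀ j, ∑ i, T i j = b.real (q ⁻¹' {j.1})) :
    ∃ π : Measure (X × X), IsCoupling π a b ∧
      ∫⁻ p, edist (q p.1) (q p.2) ∂π = ∑ i, ∑ j, ENNReal.ofReal (T i j) * edist i.1 j.1 := by
  -- A cell of measure zero carries no mass of `T`, so the junk value of `cond` there is harmless.
  have hcond : ∀ (ν : Measure X) [IsFiniteMeasure ν] (i : q.range) (t : ℝ), 0 ≤ t →
      t ≤ ν.real (q ⁻¹' {i.1}) →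
      ENNReal.ofReal t * (ν[|q ⁻¹' {i.1}]) Set.univ = ENNReal.ofReal t := by
    intro ν _ i t ht htc
    by_cases h : ν (q ⁻¹' {i.1}) = 0
    · have : t = 0 := le_antisymm (by simpa [Measure.real, h] using htc) ht
      simp [this]
    · have := cond_isProbabilityMeasure h
      simp
  have hle_a : ∀ i j, T i j ≤ a.real (q ⁻¹' {i.1}) := fun i j =>
    (Finset.single_le_sum (fun j _ => hT i j) (Finset.mem_univ j)).trans_eq (hTa i)
  have hle_b : ∀ i j, T i j ≤ b.real (q ⁻¹' {j.1}) := fun i j =>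
    (Finset.single_le_sum (fun i _ => hT i j) (Finset.mem_univ i)).trans_eq (hTb j)
  refine ⟨∑ i, ∑ j, ENNReal.ofReal (T i j) • (a[|q ⁻¹' {i.1}]).prod (b[|q ⁻¹' {j.1}]),
    ⟨?_, ?_⟩, ?_⟩
  · simp only [← Measure.mapₗ_apply_of_measurable measurable_fst, map_sum, map_smul]
    simp only [Measure.mapₗ_apply_of_measurable measurable_fst, Measure.map_fst_prod, smul_smul,
      hcond b _ _ (hT _ _) (hle_b _ _), ← Finset.sum_smul]
    simp only [← ENNReal.ofReal_sum_of_nonneg fun j _ => hT _ j, hTa, measureReal_smul_cond]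
    exact sum_restrict_preimage a q
  · simp only [← Measure.mapₗ_apply_of_measurable measurable_snd, map_sum, map_smul]
    simp only [Measure.mapₗ_apply_of_measurable measurable_snd, Measure.map_snd_prod, smul_smul,
      hcond a _ _ (hT _ _) (hle_a _ _)]
    rw [Finset.sum_comm]
    simp only [← Finset.sum_smul]
    simp only [← ENNReal.ofReal_sum_of_nonneg fun j _ => hT j _, hTb, measureReal_smul_cond]
    exact sum_restrict_preimage b q
  · simp only [lintegral_finsetSum_measure, lintegral_smul_measure, smul_eq_mul]
    refine Finset.sum_congr rfl fun i _ => Finset.sum_congr rfl fun j _ => ?_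
    have h1 : ∀ᵐ p ∂((a[|q ⁻¹' {i.1}]).prod (b[|q ⁻¹' {j.1}])),
        edist (q p.1) (q p.2) = edist i.1 j.1 := by
      have h2 := Measure.quasiMeasurePreserving_fst (μ := a[|q ⁻¹' {i.1}])
        (ν := b[|q ⁻¹' {j.1}]) |>.ae (ae_cond_mem (q.measurableSet_fiber i.1))
      have h3 := Measure.quasiMeasurePreserving_snd (μ := a[|q ⁻¹' {i.1}])
        (ν := b[|q ⁻¹' {j.1}]) |>.ae (ae_cond_mem (q.measurableSet_fiber j.1))
      filter_upwards [h2, h3] with p hp hp'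
      simp only [Set.mem_preimage, Set.mem_singleton_iff] at hp hp'
      rw [hp, hp']
    rw [lintegral_congr_ae h1, lintegral_const, ← Set.univ_prod_univ, Measure.prod_prod,
      mul_left_comm, ← mul_assoc (ENNReal.ofReal _), hcond a _ _ (hT _ _) (hle_a _ _),
      hcond b _ _ (hT _ _) (hle_b _ _), mul_comm]

theorem integral_simpleFunc_comp {X : Type*} [MeasurableSpace X] (a : Measure X)
    [IsFiniteMeasure a] (q : SimpleFunc X X) (f : X → ℝ) :
    ∫ x, f (q x) ∂a = ∑ i : q.range, f i.1 * a.real (q ⁻¹' {i.1}) := by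
  have hint : Integrable (fun x => f (q x)) a :=
    (q.map f).integrable_of_isFiniteMeasure
  conv_lhs => rw [← sum_restrict_preimage a q]
  rw [integral_finsetSum_measure fun i _ => hint.restrict]
  refine Finset.sum_congr rfl fun i _ => ?_
  rw [setIntegral_congr_fun (g := fun _ => f i.1) (q.measurableSet_fiber i.1)
    fun x hx => by rw [show q x = i.1 from hx]]
  simp [mul_comm]

theorem integrable_of_lipschitzWith {E : Type*} [NormedAddCommGroup E] [MeasurableSpace E]
    [BorelSpace E] [SecondCountableTopology E] {f : E → ℝ} {K : NNReal} (hf : LipschitzWith K f)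
    {ν : Measure E} [IsFiniteMeasure ν] (hν : Integrable id ν) : Integrable f ν := by
  refine ((integrable_const |f 0|).add (hν.norm.const_mul (K : ℝ))).mono'
    hf.continuous.aestronglyMeasurable (Filter.Eventually.of_forall fun x => ?_)
  have := hf.dist_le_mul x 0
  simp only [dist_zero_right, Real.dist_eq] at this
  simp only [Pi.add_apply, id, Real.norm_eq_abs]
  linarith [abs_sub_abs_le_abs_sub (f x) (f 0)]

/-- The dual bound up to twice the distance of the simple function `q` from the identity, by finite
duality between the values of `q`. -/
theorem W₁_le_of_simpleFunc {E : Type*} [NormedAddCommGroup E] [MeasurableSpace E]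
    [BorelSpace E] [SecondCountableTopology E] (a b : Measure E) [IsFiniteMeasure a]
    [IsFiniteMeasure b] (hab : a Set.univ = b Set.univ) (ha : Integrable id a)
    (hb : Integrable id b) (v : ℝ)
    (hv : ∀ f : E → ℝ, LipschitzWith 1 f → ∫ x, f x ∂b - ∫ x, f x ∂a ≤ v) (q : SimpleFunc E E) :
    W₁ a b ≤ ENNReal.ofReal v + 2 * ∫⁻ x, ‖q x - x‖ₑ ∂(a + b) := by
  have hqa : Integrable (fun x => q x - x) a := q.integrable_of_isFiniteMeasure.sub ha
  have hqb : Integrable (fun x => q x - x) b := q.integrable_of_isFiniteMeasure.sub hb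
  have hv0 : 0 ≤ v := by simpa using hv (fun _ => 0) (LipschitzWith.const' 0)
  set δa := ∫ x, ‖q x - x‖ ∂a with hδa
  set δb := ∫ x, ‖q x - x‖ ∂b with hδb
  have hδ : ∫⁻ x, ‖q x - x‖ₑ ∂(a + b) = ENNReal.ofReal (δa + δb) := by
    rw [lintegral_add_measure, ENNReal.ofReal_add (by positivity) (by positivity), hδa, hδb,
      ofReal_integral_norm_eq_lintegral_enorm hqa, ofReal_integral_norm_eq_lintegral_enorm hqb]
  have hsum : ∀ (ν : Measure E) [IsFiniteMeasure ν], ∑ i : q.range, ν.real (q ⁻¹' {i.1}) =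
      ν.real Set.univ := by
    intro ν _
    simpa using (integral_simpleFunc_comp ν q fun _ => 1).symm
  have hlip : ∀ f : E → ℝ, LipschitzWith 1 f → ∀ (ν : Measure E) [IsFiniteMeasure ν],
      Integrable id ν → Integrable f ν ∧ |∫ x, f (q x) ∂ν - ∫ x, f x ∂ν| ≤ ∫ x, ‖q x - x‖ ∂ν := by
    intro f hf ν _ hν
    have hfi := integrable_of_lipschitzWith hf hν
    refine ⟨hfi, ?_⟩
    have hfq : Integrable (fun x => f (q x)) ν := (q.map f).integrable_of_isFiniteMeasure
    rw [← integral_sub hfq hfi, ← Real.norm_eq_abs]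
    refine (norm_integral_le_integral_norm _).trans (integral_mono_of_nonneg
      (Filter.Eventually.of_forall fun _ => norm_nonneg _)
      (q.integrable_of_isFiniteMeasure.sub hν).norm (Filter.Eventually.of_forall fun x => ?_))
    simpa [dist_eq_norm] using hf.dist_le_mul (q x) x
  obtain ⟨T, hT, hTa, hTb, hTv⟩ := exists_transport_plan_of_dual_le (fun i : q.range => i.1)
    (fun i => a.real (q ⁻¹' {i.1})) (fun i => b.real (q ⁻¹' {i.1}))
    (fun _ => measureReal_nonneg) (fun _ => measureReal_nonneg)
    (by rw [hsum, hsum, Measure.real, hab, Measure.real]) (v + (δa + δb)) (by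
      intro f hf
      simp only [mul_sub, Finset.sum_sub_distrib, ← integral_simpleFunc_comp]
      have h1 := (abs_le.1 (hlip f hf a ha).2).1
      have h2 := (abs_le.1 (hlip f hf b hb).2).2
      linarith [hv f hf])
  obtain ⟨π, hπ, hcost⟩ := exists_isCoupling_of_plan a b q T hT hTa hTb
  have hcost' : ∫⁻ p, edist (q p.1) (q p.2) ∂π ≤ ENNReal.ofReal (v + (δa + δb)) := by
    rw [hcost]
    refine le_trans (le_of_eq ?_) (ENNReal.ofReal_le_ofReal hTv)
    rw [ENNReal.ofReal_sum_of_nonneg fun i _ => Finset.sum_nonneg fun j _ =>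
      mul_nonneg (hT i j) dist_nonneg]
    refine Finset.sum_congr rfl fun i _ => ?_
    rw [ENNReal.ofReal_sum_of_nonneg fun j _ => mul_nonneg (hT i j) dist_nonneg]
    exact Finset.sum_congr rfl fun j _ => by rw [ENNReal.ofReal_mul (hT i j), edist_dist]
  have hm : Measurable fun x => ‖q x - x‖ₑ := (q.measurable.sub measurable_id).enorm
  calc W₁ a b ≤ ∫⁻ p, edist p.1 p.2 ∂π := W₁_le_of_isCoupling hπ
    _ ≤ ∫⁻ p, (‖q p.1 - p.1‖ₑ + (edist (q p.1) (q p.2) + ‖q p.2 - p.2‖ₑ)) ∂π := by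
      refine lintegral_mono fun p => ?_
      rw [← edist_eq_enorm_sub, ← edist_eq_enorm_sub, edist_comm (q p.1), ← add_assoc]
      exact edist_triangle4 _ _ _ _
    _ = ∫⁻ x, ‖q x - x‖ₑ ∂a + (∫⁻ p, edist (q p.1) (q p.2) ∂π + ∫⁻ x, ‖q x - x‖ₑ ∂b) := by
      have hm1 : Measurable fun p : E × E => ‖q p.1 - p.1‖ₑ := hm.comp measurable_fst
      have hm2 : Measurable fun p : E × E => ‖q p.2 - p.2‖ₑ := hm.comp measurable_snd
      rw [lintegral_add_left hm1, lintegral_add_right _ hm2, hπ.lintegral_fst hm, hπ.lintegral_snd hm]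
    _ = ∫⁻ p, edist (q p.1) (q p.2) ∂π + ∫⁻ x, ‖q x - x‖ₑ ∂(a + b) := by
      rw [lintegral_add_measure]
      ring
    _ ≤ ENNReal.ofReal (v + (δa + δb)) + ∫⁻ x, ‖q x - x‖ₑ ∂(a + b) := by gcongr
    _ = ENNReal.ofReal v + 2 * ∫⁻ x, ‖q x - x‖ₑ ∂(a + b) := by
      rw [ENNReal.ofReal_add hv0 (by positivity), hδ]
      ring

/-- **Kantorovich–Rubinstein duality**, the hard inequality: a bound on `∫ f db - ∫ f da` over all
`1`-Lipschitz `f` bounds the transport cost, for finite measures with a first moment. -/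
theorem W₁_le_of_forall_lipschitz {E : Type*} [NormedAddCommGroup E] [MeasurableSpace E]
    [BorelSpace E] [SecondCountableTopology E] (a b : Measure E) [IsFiniteMeasure a]
    [IsFiniteMeasure b] (hab : a Set.univ = b Set.univ) (ha : Integrable id a)
    (hb : Integrable id b) (v : ℝ)
    (hv : ∀ f : E → ℝ, LipschitzWith 1 f → ∫ x, f x ∂b - ∫ x, f x ∂a ≤ v) :
    W₁ a b ≤ ENNReal.ofReal v := by
  have h := SimpleFunc.tendsto_approxOn_L1_enorm (μ := a + b) (measurable_id (α := E))
    (Set.mem_univ (0 : E)) (by simp) (by simpa using! (ha.add_measure hb).hasFiniteIntegral)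
  have h2 := (ENNReal.Tendsto.const_mul h (Or.inr (ENNReal.ofNat_ne_top (n := 2)))).const_add
    (ENNReal.ofReal v)
  rw [mul_zero, add_zero] at h2
  exact ge_of_tendsto' h2 fun k => W₁_le_of_simpleFunc a b hab ha hb v hv _

/-! ### Measures whose difference has a density -/

/-- Mass common to both measures can be left in place. -/
theorem W₁_add_left_le {X : Type*} [PseudoEMetricSpace X] [MeasurableSpace X]
    [OpensMeasurableSpace X] [SecondCountableTopology X] (κ a b : Measure X) :
    W₁ (κ + a) (κ + b) ≤ W₁ a b := by
  refine le_iInf₂ fun π hπ => ?_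
  have hd : Measurable fun x : X => (x, x) := measurable_id.prodMk measurable_id
  refine (W₁_le_of_isCoupling (π := κ.map (fun x => (x, x)) + π) ⟨?_, ?_⟩).trans_eq ?_
  · rw [Measure.map_add _ _ measurable_fst, hπ.1, Measure.map_map measurable_fst hd]
    exact congrArg (· + a) Measure.map_id
  · rw [Measure.map_add _ _ measurable_snd, hπ.2, Measure.map_map measurable_snd hd]
    exact congrArg (· + b) Measure.map_id
  · rw [lintegral_add_measure, lintegral_map measurable_edist hd]
    simp

/-- If `ν₁ - ν₀` has density `α` with respect to `μ`, then `ν₀` and `ν₁` consist of a common part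
and of the measures with densities `α⁻` and `α⁺`. -/
theorem exists_common_part {X : Type*} [MeasurableSpace X] {μ ν₀ ν₁ : Measure X}
    [IsFiniteMeasure μ] [IsFiniteMeasure ν₀] [IsFiniteMeasure ν₁] {α : X → ℝ} (hα : Measurable α)
    (hint : Integrable α μ)
    (h : μ.withDensityᵥ α = ν₁.toSignedMeasure - ν₀.toSignedMeasure) :
    ∃ κ : Measure X, IsFiniteMeasure κ ∧
      ν₀ = κ + μ.withDensity (fun x => ENNReal.ofReal (-α x)) ∧
      ν₁ = κ + μ.withDensity (fun x => ENNReal.ofReal (α x)) := by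
  have : IsFiniteMeasure (μ.withDensity fun x => ENNReal.ofReal (α x)) :=
    isFiniteMeasure_withDensity_ofReal hint.2
  have : IsFiniteMeasure (μ.withDensity fun x => ENNReal.ofReal (-α x)) :=
    isFiniteMeasure_withDensity_ofReal hint.neg.2
  set b := μ.withDensity fun x => ENNReal.ofReal (α x) with hb
  set a := μ.withDensity fun x => ENNReal.ofReal (-α x) with ha
  have hbal : ν₁ + a = ν₀ + b := by
    ext A hA
    have h1 : (b A).toReal - (a A).toReal = ν₁.real A - ν₀.real A := by
      have := congrArg (fun v => v A) h
      simp only [withDensityᵥ_apply hint hA, sub_apply,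
        Measure.toSignedMeasure_apply_measurable hA] at this
      rw [← this, integral_eq_lintegral_pos_part_sub_lintegral_neg_part hint.restrict,
        hb, ha, withDensity_apply _ hA, withDensity_apply _ hA]
    rw [Measure.add_apply, Measure.add_apply, ← ENNReal.toReal_eq_toReal_iff' (by finiteness)
      (by finiteness), ENNReal.toReal_add (by finiteness) (by finiteness),
      ENNReal.toReal_add (by finiteness) (by finiteness)]
    simp only [Measure.real] at h1
    linarith
  -- `a` lives on `{α < 0}`, where `b` vanishes and the balance `hbal` bounds `a` by `ν₀`.
  have hle : a ≤ ν₀ := by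
    refine Measure.le_iff.2 fun A hA => ?_
    have hN : MeasurableSet {x | α x < 0} := measurableSet_lt hα measurable_const
    have h1 : a (A \ {x | α x < 0}) = 0 := by
      rw [ha, withDensity_apply _ (hA.diff hN),
        setLIntegral_congr_fun (g := fun _ => 0) (hA.diff hN) fun x hx => ?_, lintegral_zero]
      exact ENNReal.ofReal_eq_zero.2 (by simpa using hx.2)
    have h2 : b (A ∩ {x | α x < 0}) = 0 := by
      rw [hb, withDensity_apply _ (hA.inter hN),
        setLIntegral_congr_fun (g := fun _ => 0) (hA.inter hN) fun x hx => ?_, lintegral_zero]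
      exact ENNReal.ofReal_eq_zero.2 hx.2.le
    calc a A = a (A ∩ {x | α x < 0}) := by rw [← measure_inter_add_sdiff A hN, h1, add_zero]
      _ ≤ (ν₁ + a) (A ∩ {x | α x < 0}) := by
        rw [Measure.add_apply]
        exact le_add_self
      _ = ν₀ (A ∩ {x | α x < 0}) := by rw [hbal, Measure.add_apply, h2, add_zero]
      _ ≤ ν₀ A := measure_mono Set.inter_subset_left
  have h0 : ν₀ = ν₀ - a + a := (Measure.sub_add_cancel_of_le hle).symm
  refine ⟨ν₀ - a, inferInstance, h0, ?_⟩
  rw [h0, add_assoc, add_comm a b, ← add_assoc] at hbal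
  ext A hA
  have := congrArg (fun ν : Measure X => ν A) hbal
  simp only [Measure.add_apply _ a] at this
  exact (ENNReal.add_left_inj (measure_ne_top a A)).1 this

theorem integrable_ofReal_toReal_mul {X : Type*} [MeasurableSpace X] {μ : Measure X}
    {α f : X → ℝ} (hα : Measurable α) (hfm : AEStronglyMeasurable f μ)
    (hf : Integrable (fun x => α x * f x) μ) :
    Integrable (fun x => (ENNReal.ofReal (α x)).toReal • f x) μ := by
  refine hf.mono ((hα.ennreal_ofReal.ennreal_toReal.aestronglyMeasurable).smul hfm)
    (Filter.Eventually.of_forall fun x => ?_)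
  rw [norm_smul, norm_mul, ENNReal.toReal_ofReal']
  refine mul_le_mul_of_nonneg_right ?_ (norm_nonneg _)
  rw [Real.norm_eq_abs, Real.norm_eq_abs, abs_of_nonneg (le_max_right _ _)]
  exact max_le (le_abs_self _) (abs_nonneg _)

theorem integral_withDensity_pos_sub_neg {X : Type*} [MeasurableSpace X] {μ : Measure X}
    {α f : X → ℝ} (hα : Measurable α) (hfm : AEStronglyMeasurable f μ)
    (hf : Integrable (fun x => α x * f x) μ) :
    ∫ x, f x ∂μ.withDensity (fun x => ENNReal.ofReal (α x)) -
      ∫ x, f x ∂μ.withDensity (fun x => ENNReal.ofReal (-α x)) = ∫ x, α x * f x ∂μ := by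
  have hα' : Measurable fun x => -α x := hα.neg
  rw [integral_withDensity_eq_integral_toReal_smul hα.ennreal_ofReal (by simp),
    integral_withDensity_eq_integral_toReal_smul hα'.ennreal_ofReal (by simp),
    ← integral_sub (integrable_ofReal_toReal_mul hα hfm hf)
      (integrable_ofReal_toReal_mul hα' hfm (by simpa using hf.neg))]
  refine integral_congr_ae (Filter.Eventually.of_forall fun x => ?_)
  simp only [ENNReal.toReal_ofReal', smul_eq_mul]
  rw [← sub_mul]
  congr 1
  rcases le_total 0 (α x) with h | h
  · rw [max_eq_left h, max_eq_right (neg_nonpos.2 h), sub_zero]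
  · rw [max_eq_right h, max_eq_left (neg_nonneg.2 h), zero_sub, neg_neg]

theorem integrable_withDensity_ofReal {X : Type*} [MeasurableSpace X] {μ : Measure X}
    {F : Type*} [NormedAddCommGroup F] [NormedSpace ℝ F] [MeasurableSpace F] [BorelSpace F]
    {α : X → ℝ} {f : X → F} (hα : Measurable α)
    (hfm : AEStronglyMeasurable f μ) (hf : Integrable (fun x => α x * ‖f x‖) μ) :
    Integrable f (μ.withDensity fun x => ENNReal.ofReal (α x)) := by
  rw [integrable_withDensity_iff_integrable_smul' hα.ennreal_ofReal (by simp)]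
  refine (integrable_norm_iff (hα.ennreal_ofReal.ennreal_toReal.aestronglyMeasurable.smul hfm)).1 ?_
  refine (integrable_ofReal_toReal_mul hα hfm.norm hf).congr
    (Filter.Eventually.of_forall fun x => ?_)
  simp [norm_smul]

/-- The dual bound for measures whose difference has a square integrable density: no moments of
`ν₀` and `ν₁` themselves are needed, since only the densities `α⁻` and `α⁺` are transported. -/
theorem W₁_le_of_density {E : Type*} [NormedAddCommGroup E] [NormedSpace ℝ E] [MeasurableSpace E]
    [BorelSpace E] [SecondCountableTopology E] {μ ν₀ ν₁ : Measure E} [IsFiniteMeasure μ]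
    [IsProbabilityMeasure ν₀] [IsProbabilityMeasure ν₁] (hμ : MemLp id 2 μ) {α : E → ℝ}
    (hαm : Measurable α) (hα : MemLp α 2 μ)
    (h : μ.withDensityᵥ α = ν₁.toSignedMeasure - ν₀.toSignedMeasure) (v : ℝ)
    (hv : ∀ f : E → ℝ, LipschitzWith 1 f → MemLp f 2 μ → ∫ x, α x * f x ∂μ ≤ v) :
    W₁ ν₀ ν₁ ≤ ENNReal.ofReal v := by
  have hαi : Integrable α μ := hα.integrable (by norm_num)
  have : IsFiniteMeasure (μ.withDensity fun x => ENNReal.ofReal (α x)) :=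
    isFiniteMeasure_withDensity_ofReal hαi.2
  have : IsFiniteMeasure (μ.withDensity fun x => ENNReal.ofReal (-α x)) :=
    isFiniteMeasure_withDensity_ofReal hαi.neg.2
  obtain ⟨κ, hκ, h0, h1⟩ := exists_common_part hαm hαi h
  have hmass : μ.withDensity (fun x => ENNReal.ofReal (-α x)) Set.univ =
      μ.withDensity (fun x => ENNReal.ofReal (α x)) Set.univ := by
    have e0 := congrArg (fun ν : Measure E => ν Set.univ) h0
    have e1 := congrArg (fun ν : Measure E => ν Set.univ) h1
    simp only [measure_univ, Measure.add_apply] at e0 e1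
    exact (ENNReal.add_right_inj (measure_ne_top κ Set.univ)).1 (e0.symm.trans e1)
  rw [h0, h1]
  have hm2 : MemLp (fun x : E => ‖x‖) 2 μ := hμ.norm
  have hlip : ∀ f : E → ℝ, LipschitzWith 1 f → MemLp f 2 μ := by
    intro f hf
    have h2 := (memLp_const (μ := μ) (p := 2) |f 0|).add hm2
    refine h2.mono' hf.continuous.aestronglyMeasurable (Filter.Eventually.of_forall fun x => ?_)
    have := hf.dist_le_mul x 0
    simp only [NNReal.coe_one, one_mul, dist_zero_right, Real.dist_eq] at this
    rw [Real.norm_eq_abs, Pi.add_apply]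
    linarith [abs_sub_abs_le_abs_sub (f x) (f 0)]
  have hmom : Integrable (fun x => α x * ‖x‖) μ := hα.integrable_mul hm2
  have hαm' : Measurable fun x => -α x := hαm.neg
  have hmom' : Integrable (fun x => -α x * ‖x‖) μ := by simpa using hmom.neg
  have i0 := integrable_withDensity_ofReal (f := id) hαm' hμ.aestronglyMeasurable hmom'
  have i1 := integrable_withDensity_ofReal (f := id) hαm hμ.aestronglyMeasurable hmom
  refine (W₁_add_left_le κ _ _).trans (W₁_le_of_forall_lipschitz _ _ hmass i0 i1 v
    fun f hf => ?_)
  rw [integral_withDensity_pos_sub_neg hαm hf.continuous.aestronglyMeasurable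
    (hα.integrable_mul (hlip f hf))]
  exact hv f hf (hlip f hf)

theorem integral_sub_integral_eq_of_density {X : Type*} [MeasurableSpace X]
    {μ ν₀ ν₁ : Measure X} [IsFiniteMeasure μ] [IsFiniteMeasure ν₀] [IsFiniteMeasure ν₁]
    {α : X → ℝ} (hαm : Measurable α) (hα : Integrable α μ)
    (h : μ.withDensityᵥ α = ν₁.toSignedMeasure - ν₀.toSignedMeasure)
    {f : X → ℝ} (hf : Measurable f) {C : ℝ} (hC : ∀ x, |f x| ≤ C) :
    ∫ x, f x ∂ν₁ - ∫ x, f x ∂ν₀ = ∫ x, α x * f x ∂μ := by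
  have : IsFiniteMeasure (μ.withDensity fun x => ENNReal.ofReal (α x)) :=
    isFiniteMeasure_withDensity_ofReal hα.2
  have : IsFiniteMeasure (μ.withDensity fun x => ENNReal.ofReal (-α x)) :=
    isFiniteMeasure_withDensity_ofReal hα.neg.2
  obtain ⟨κ, hκ, h0, h1⟩ := exists_common_part hαm hα h
  have hi : ∀ (ν : Measure X) [IsFiniteMeasure ν], Integrable f ν := fun ν _ =>
    Integrable.of_bound hf.aestronglyMeasurable C (Filter.Eventually.of_forall hC)
  rw [h0, h1, integral_add_measure (hi _) (hi _), integral_add_measure (hi _) (hi _),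
    add_sub_add_left_eq_sub, integral_withDensity_pos_sub_neg hαm hf.aestronglyMeasurable]
  exact hα.mul_bdd (c := C) hf.aestronglyMeasurable (Filter.Eventually.of_forall hC)

/-- **Kantorovich–Rubinstein duality**, the easy inequality. The Lipschitz function is truncated
because it need not be integrable with respect to `ν₀` and `ν₁`. -/
theorem ofReal_integral_mul_le_W₁ {E : Type*} [PseudoMetricSpace E] [MeasurableSpace E]
    [BorelSpace E] [SecondCountableTopology E] {μ ν₀ ν₁ : Measure E} [IsFiniteMeasure μ]
    [IsProbabilityMeasure ν₀] [IsProbabilityMeasure ν₁] {α : E → ℝ}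
    (hαm : Measurable α) (hα : Integrable α μ)
    (h : μ.withDensityᵥ α = ν₁.toSignedMeasure - ν₀.toSignedMeasure)
    {f : E → ℝ} (hf : LipschitzWith 1 f) (hfα : Integrable (fun x => α x * f x) μ) :
    ENNReal.ofReal (∫ x, α x * f x ∂μ) ≤ W₁ ν₀ ν₁ := by
  refine le_iInf₂ fun π hπ => ?_
  by_cases hfin : ∫⁻ p, edist p.1 p.2 ∂π = ⊤
  · rw [hfin]
    exact le_top
  have hπf : IsFiniteMeasure π := by
    refine ⟨?_⟩
    have : π Set.univ = 1 := by
      rw [← measure_univ (μ := ν₀), ← hπ.1, Measure.map_apply measurable_fst .univ,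
        Set.preimage_univ]
    simp [this]
  have hdist : Integrable (fun p : E × E => dist p.1 p.2) π := by
    refine ⟨(continuous_dist.aestronglyMeasurable), ?_⟩
    rw [hasFiniteIntegral_iff_enorm]
    refine lt_of_eq_of_lt (lintegral_congr fun p => ?_) (lt_top_iff_ne_top.2 hfin)
    rw [edist_dist, Real.enorm_of_nonneg dist_nonneg]
  have hcost : ENNReal.ofReal (∫ p, dist p.1 p.2 ∂π) = ∫⁻ p, edist p.1 p.2 ∂π := by
    rw [ofReal_integral_eq_lintegral_ofReal hdist (Filter.Eventually.of_forall fun _ =>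
      dist_nonneg)]
    exact lintegral_congr fun p => (edist_dist _ _).symm
  rw [← hcost]
  refine ENNReal.ofReal_le_ofReal ?_
  set g : ℕ → E → ℝ := fun k x => max (-(k : ℝ)) (min k (f x)) with hg
  have hgl : ∀ k, LipschitzWith 1 (g k) := fun k => (hf.const_min _).const_max _
  have hgb : ∀ k x, |g k x| ≤ k := fun k x => abs_le.2 ⟨le_max_left _ _,
    max_le (by linarith [k.cast_nonneg (α := ℝ)]) (min_le_left _ _)⟩
  have hgf : ∀ k x, |g k x| ≤ |f x| := fun k x => by
    have hk := k.cast_nonneg (α := ℝ)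
    simp only [hg]
    refine abs_le.2 ⟨?_, max_le ((neg_nonpos.2 hk).trans (abs_nonneg _))
      ((min_le_right _ _).trans (le_abs_self _))⟩
    exact (le_min ((neg_nonpos.2 (abs_nonneg _)).trans hk) (neg_abs_le _)).trans (le_max_right _ _)
  have hglim : ∀ x, Filter.Tendsto (fun k => g k x) Filter.atTop (nhds (f x)) := fun x => by
    obtain ⟨N, hN⟩ := exists_nat_ge |f x|
    refine tendsto_const_nhds.congr' ?_
    filter_upwards [Filter.eventually_ge_atTop N] with k hk
    have : |f x| ≤ k := hN.trans (by exact_mod_cast hk)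
    obtain ⟨h1, h2⟩ := abs_le.1 this
    simp [hg, h1, h2]
  have hlim : Filter.Tendsto (fun k => ∫ x, α x * g k x ∂μ) Filter.atTop
      (nhds (∫ x, α x * f x ∂μ)) := by
    refine tendsto_integral_of_dominated_convergence (fun x => |α x * f x|)
      (fun k => hαm.aestronglyMeasurable.mul (hgl k).continuous.aestronglyMeasurable)
      hfα.norm (fun k => Filter.Eventually.of_forall fun x => ?_)
      (Filter.Eventually.of_forall fun x => (hglim x).const_mul _)
    rw [Real.norm_eq_abs, abs_mul, abs_mul]
    exact mul_le_mul_of_nonneg_left (hgf k x) (abs_nonneg _)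
  refine le_of_tendsto' hlim fun k => ?_
  have hgc := (hgl k).continuous
  have hi1 : Integrable (fun p : E × E => g k p.1) π := Integrable.of_bound
    (hgc.comp continuous_fst).aestronglyMeasurable k (Filter.Eventually.of_forall fun p => hgb k _)
  have hi2 : Integrable (fun p : E × E => g k p.2) π := Integrable.of_bound
    (hgc.comp continuous_snd).aestronglyMeasurable k (Filter.Eventually.of_forall fun p => hgb k _)
  rw [← integral_sub_integral_eq_of_density hαm hα h hgc.measurable (hgb k)]
  have e1 : ∫ x, g k x ∂ν₁ = ∫ p, g k p.2 ∂π := by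
    rw [← hπ.2, integral_map measurable_snd.aemeasurable hgc.aestronglyMeasurable]
  have e0 : ∫ x, g k x ∂ν₀ = ∫ p, g k p.1 ∂π := by
    rw [← hπ.1, integral_map measurable_fst.aemeasurable hgc.aestronglyMeasurable]
  rw [e1, e0, ← integral_sub hi2 hi1]
  refine integral_mono (hi2.sub hi1) hdist fun p => ?_
  have := (hgl k).dist_le_mul p.2 p.1
  rw [NNReal.coe_one, one_mul, Real.dist_eq, dist_comm] at this
  exact (le_abs_self _).trans this

/-! ### Divergence fields against Lipschitz functions -/

/-- A bump function at the origin with outer radius `ε`. -/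
noncomputable def bumpOfRadius {E : Type*} [NormedAddCommGroup E] {ε : ℝ} (hε : 0 < ε) :
    ContDiffBump (0 : E) where
  rIn := ε / 2
  rOut := ε
  rIn_pos := half_pos hε
  rIn_lt_rOut := half_lt_self hε

theorem lipschitzWith_normed_convolution {n : ℕ} (φ : ContDiffBump (0 : R n)) {g : R n → ℝ}
    (hg : LipschitzWith 1 g) :
    LipschitzWith 1 (φ.normed volume ⋆[ContinuousLinearMap.lsmul ℝ ℝ, volume] g) := by
  refine LipschitzWith.of_le_add fun x y => ?_
  have hi : ∀ z, Integrable (fun t => φ.normed volume t • g (z - t)) := fun z =>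
    (φ.continuous_normed.smul (hg.continuous.comp (by fun_prop))).integrable_of_hasCompactSupport
      φ.hasCompactSupport_normed.smul_right
  rw [convolution_lsmul, convolution_lsmul]
  have h1 : dist x y = ∫ t, φ.normed volume t • dist x y := (φ.integral_normed_smul _ _).symm
  rw [h1, ← integral_add (hi y) (φ.integrable_normed.smul_const _)]
  refine integral_mono (hi x) ((hi y).add (φ.integrable_normed.smul_const _)) fun t => ?_
  simp only [← smul_add]
  refine mul_le_mul_of_nonneg_left ?_ (φ.nonneg_normed t)
  have := hg.dist_le_mul (x - t) (y - t)
  rw [NNReal.coe_one, one_mul, Real.dist_eq, dist_sub_right] at this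
  linarith [le_abs_self (g (x - t) - g (y - t))]

/-- Mollification approximates uniformly without increasing the Lipschitz constant. -/
theorem exists_isFC_lipschitz_approx {n : ℕ} {g : R n → ℝ} (hg : LipschitzWith 1 g)
    (hc : HasCompactSupport g) {ε : ℝ} (hε : 0 < ε) :
    ∃ G : R n → ℝ, IsFC G ∧ LipschitzWith 1 G ∧ ∀ x, |G x - g x| ≤ ε := by
  set φ : ContDiffBump (0 : R n) := bumpOfRadius hε
  refine ⟨φ.normed volume ⋆[ContinuousLinearMap.lsmul ℝ ℝ, volume] g, ?_,
    lipschitzWith_normed_convolution φ hg, fun x => ?_⟩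
  · exact isFC_of_hasCompactSupport (φ.hasCompactSupport_normed.contDiff_convolution_left _
      φ.contDiff_normed hg.continuous.locallyIntegrable)
      (φ.hasCompactSupport_normed.convolution _ hc)
  · rw [← Real.dist_eq]
    refine φ.dist_normed_convolution_le hg.continuous.aestronglyMeasurable fun y hy => ?_
    refine (hg.dist_le_mul y x).trans ?_
    rw [NNReal.coe_one, one_mul]
    exact (Metric.mem_ball.1 hy).le

theorem norm_gradient_le_of_lipschitzWith {n : ℕ} {f : R n → ℝ} (hf : LipschitzWith 1 f)
    (x : R n) : ‖gradient f x‖ ≤ 1 := by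
  simpa [gradient] using norm_fderiv_le_of_lipschitz ℝ hf (x₀ := x)

theorem integrable_norm_Lp {n : ℕ} (u : Lp (R n) 2 (γ n)) : Integrable (fun x => ‖u x‖) (γ n) :=
  ((Lp.memLp u).integrable (by norm_num)).norm

theorem integral_mul_le_of_isFC {n : ℕ} {u : Lp (R n) 2 (γ n)} {a : Lp ℝ 2 (γ n)}
    (h : (u, a) ∈ (I n).graph) {f : R n → ℝ} (hf : IsFC f) (hl : LipschitzWith 1 f) :
    ∫ x, a x * f x ∂γ n ≤ ∫ x, ‖u x‖ ∂γ n := by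
  rw [← (mem_I_graph_iff n u a).1 h f hf]
  refine (le_abs_self _).trans ?_
  rw [← Real.norm_eq_abs]
  refine (norm_integral_le_integral_norm _).trans (integral_mono_of_nonneg
    (Filter.Eventually.of_forall fun _ => norm_nonneg _) (integrable_norm_Lp u)
    (Filter.Eventually.of_forall fun x => ?_))
  refine (norm_inner_le_norm _ _).trans ?_
  exact mul_le_of_le_one_right (norm_nonneg _) (norm_gradient_le_of_lipschitzWith hl x)

theorem integral_mul_le_of_hasCompactSupport {n : ℕ} {u : Lp (R n) 2 (γ n)} {a : Lp ℝ 2 (γ n)}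
    (h : (u, a) ∈ (I n).graph) {f : R n → ℝ} (hf : LipschitzWith 1 f)
    (hc : HasCompactSupport f) :
    ∫ x, a x * f x ∂γ n ≤ ∫ x, ‖u x‖ ∂γ n := by
  have hai : Integrable a (γ n) := (Lp.memLp a).integrable (by norm_num)
  obtain ⟨C, hC⟩ := hf.continuous.bounded_above_of_compact_support hc
  have hfi : Integrable (fun x => a x * f x) (γ n) := hai.mul_bdd (c := C)
    hf.continuous.aestronglyMeasurable (Filter.Eventually.of_forall hC)
  refine le_of_forall_pos_le_add fun δ hδ => ?_
  set A := ∫ x, |a x| ∂γ n with hA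
  have hA0 : 0 ≤ A := integral_nonneg fun _ => abs_nonneg _
  obtain ⟨G, hG, hGl, hGf⟩ := exists_isFC_lipschitz_approx hf hc
    (ε := δ / (A + 1)) (by positivity)
  have hGi : Integrable (fun x => a x * G x) (γ n) := (Lp.memLp a).integrable_mul hG.memLp
  have h1 := integral_mul_le_of_isFC h hG hGl
  have h2 : ∫ x, a x * f x ∂γ n ≤ ∫ x, (a x * G x + |a x| * (δ / (A + 1))) ∂γ n := by
    refine integral_mono hfi (hGi.add (hai.abs.mul_const _)) fun x => ?_
    have : a x * (f x - G x) ≤ |a x| * (δ / (A + 1)) := by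
      refine (le_abs_self _).trans ?_
      rw [abs_mul, abs_sub_comm]
      exact mul_le_mul_of_nonneg_left (hGf x) (abs_nonneg _)
    simp only
    linarith
  rw [integral_add hGi (hai.abs.mul_const _), integral_mul_const, ← hA] at h2
  have h3 : A * (δ / (A + 1)) ≤ δ := by
    rw [mul_div_assoc', div_le_iff₀ (by positivity)]
    nlinarith
  linarith

/-- The function `f` cut off outside the ball of radius `r` by clamping its values between
`±(r - |x|)⁺`, which keeps a `1`-Lipschitz function `1`-Lipschitz. -/
noncomputable def coneCutoff {E : Type*} [NormedAddCommGroup E] (f : E → ℝ) (r : ℝ) (x : E) : ℝ :=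
  max (-max 0 (r - ‖x‖)) (min (max 0 (r - ‖x‖)) (f x))

theorem LipschitzWith.coneCutoff {E : Type*} [NormedAddCommGroup E] {f : E → ℝ}
    (hf : LipschitzWith 1 f) (r : ℝ) : LipschitzWith 1 (coneCutoff f r) := by
  have h0 : LipschitzWith 1 fun x : E => max 0 (r - ‖x‖) := by
    refine LipschitzWith.const_max ?_ 0
    refine LipschitzWith.of_le_add fun x y => ?_
    have := norm_sub_norm_le y x
    rw [dist_comm, dist_eq_norm]
    linarith
  have := h0.neg.max (h0.min hf)
  simpa using! this

theorem hasCompactSupport_coneCutoff {E : Type*} [NormedAddCommGroup E] [ProperSpace E]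
    (f : E → ℝ) (r : ℝ) : HasCompactSupport (coneCutoff f r) := by
  refine HasCompactSupport.intro (isCompact_closedBall 0 r) fun x hx => ?_
  have hx : r < ‖x‖ := by simpa using hx
  rw [coneCutoff, max_eq_left (a := (0 : ℝ)) (by linarith)]
  rcases le_total 0 (f x) with h | h <;> simp [h]

theorem abs_coneCutoff_le {E : Type*} [NormedAddCommGroup E] (f : E → ℝ) (r : ℝ) (x : E) :
    |coneCutoff f r x| ≤ |f x| := by
  have hk : 0 ≤ max 0 (r - ‖x‖) := le_max_left _ _
  refine abs_le.2 ⟨?_, max_le ((neg_nonpos.2 hk).trans (abs_nonneg _))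
    ((min_le_right _ _).trans (le_abs_self _))⟩
  exact (le_min ((neg_nonpos.2 (abs_nonneg _)).trans hk) (neg_abs_le _)).trans (le_max_right _ _)

theorem coneCutoff_eq {E : Type*} [NormedAddCommGroup E] {f : E → ℝ} {r : ℝ} {x : E}
    (h : |f x| + ‖x‖ ≤ r) : coneCutoff f r x = f x := by
  have h1 : |f x| ≤ max 0 (r - ‖x‖) := (le_sub_iff_add_le.2 h).trans (le_max_right _ _)
  rw [coneCutoff, min_eq_right ((le_abs_self _).trans h1),
    max_eq_right ((neg_le_neg h1).trans (neg_abs_le _))]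

/-- If `u` has divergence `a` then `‖u‖₁` bounds the integral of `a` against every `1`-Lipschitz
function. -/
theorem integral_mul_le_integral_norm {n : ℕ} {u : Lp (R n) 2 (γ n)} {a : Lp ℝ 2 (γ n)}
    (h : (u, a) ∈ (I n).graph) {f : R n → ℝ} (hf : LipschitzWith 1 f) (hf2 : MemLp f 2 (γ n)) :
    ∫ x, a x * f x ∂γ n ≤ ∫ x, ‖u x‖ ∂γ n := by
  have hlim : Filter.Tendsto (fun k : ℕ => ∫ x, a x * coneCutoff f k x ∂γ n) Filter.atTop
      (nhds (∫ x, a x * f x ∂γ n)) := by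
    refine tendsto_integral_of_dominated_convergence (fun x => |a x * f x|)
      (fun k => (Lp.aestronglyMeasurable a).mul
        (LipschitzWith.coneCutoff hf k).continuous.aestronglyMeasurable)
      ((Lp.memLp a).integrable_mul hf2).norm (fun k => Filter.Eventually.of_forall fun x => ?_)
      (Filter.Eventually.of_forall fun x => ?_)
    · rw [Real.norm_eq_abs, abs_mul, abs_mul]
      exact mul_le_mul_of_nonneg_left (abs_coneCutoff_le f k x) (abs_nonneg _)
    · obtain ⟨N, hN⟩ := exists_nat_ge (|f x| + ‖x‖)
      refine tendsto_const_nhds.congr' ?_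
      filter_upwards [Filter.eventually_ge_atTop N] with k hk
      rw [coneCutoff_eq (hN.trans (by exact_mod_cast hk))]
  exact le_of_tendsto' hlim fun k => integral_mul_le_of_hasCompactSupport h
    (LipschitzWith.coneCutoff hf k) (hasCompactSupport_coneCutoff f k)

/-! ### Poincaré inequality and surjectivity of the divergence -/

theorem sq_intervalIntegral_le {g : ℝ → ℝ} (hg : Continuous g) {L : ℝ} (hL : 0 < L) :
    (∫ t in (0 : ℝ)..L, g t) ^ 2 ≤ L * ∫ t in (0 : ℝ)..L, g t ^ 2 := by
  set m := (∫ t in (0 : ℝ)..L, g t) / L with hm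
  have h0 : 0 ≤ ∫ t in (0 : ℝ)..L, (g t - m) ^ 2 :=
    intervalIntegral.integral_nonneg hL.le fun _ _ => sq_nonneg _
  have h1 : ∫ t in (0 : ℝ)..L, (g t - m) ^ 2 =
      (∫ t in (0 : ℝ)..L, g t ^ 2) - 2 * m * (∫ t in (0 : ℝ)..L, g t) + m ^ 2 * L := by
    have : ∀ t, (g t - m) ^ 2 = g t ^ 2 - 2 * m * g t + m ^ 2 := fun t => by ring
    simp only [this]
    rw [intervalIntegral.integral_add, intervalIntegral.integral_sub,
      intervalIntegral.integral_const_mul, intervalIntegral.integral_const]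
    · simp [mul_comm]
    all_goals exact Continuous.intervalIntegrable (by fun_prop) _ _
  have h2 : ∫ t in (0 : ℝ)..L, g t = m * L := by rw [hm]; field_simp
  rw [h1, h2] at h0
  rw [h2]
  nlinarith

theorem continuous_gradient {n : ℕ} {f : R n → ℝ} (hf : IsFC f) : Continuous (gradient f) :=
  (InnerProductSpace.toDual ℝ (R n)).symm.continuous.comp (hf.smooth.continuous_fderiv (by simp))

/-- Fundamental theorem of calculus along the rotation that carries `x` to `y`. -/
theorem enorm_sub_sq_le_lintegral_rotation {n : ℕ} {f : R n → ℝ} (hf : IsFC f) (p : R n × R n) :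
    ‖f p.2 - f p.1‖ₑ ^ 2 ≤ ENNReal.ofReal (Real.pi / 2) *
      ∫⁻ θ in Set.Ioc 0 (Real.pi / 2),
        ‖gradient f (ContinuousLinearMap.rotation θ p).1‖ₑ ^ 2 *
          ‖(ContinuousLinearMap.rotation θ p).2‖ₑ ^ 2 := by
  have hpi : 0 < Real.pi / 2 := by positivity
  have hX : Continuous fun θ => (ContinuousLinearMap.rotation θ p).1 := by
    simp only [ContinuousLinearMap.rotation_apply]; fun_prop
  have hX' : Continuous fun θ => (ContinuousLinearMap.rotation θ p).2 := by
    simp only [ContinuousLinearMap.rotation_apply]; fun_prop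
  have hder : ∀ θ, HasDerivAt (fun θ => (ContinuousLinearMap.rotation θ p).1)
      (ContinuousLinearMap.rotation θ p).2 θ := fun θ => by
    simp only [ContinuousLinearMap.rotation_apply]
    exact ((Real.hasDerivAt_cos θ).smul_const p.1).add ((Real.hasDerivAt_sin θ).smul_const p.2)
  have hgrad := continuous_gradient hf
  set g : ℝ → ℝ := fun θ => inner ℝ (gradient f (ContinuousLinearMap.rotation θ p).1)
    (ContinuousLinearMap.rotation θ p).2 with hg
  have hgc : Continuous g := (hgrad.comp hX).inner hX'
  have hftc : ∫ θ in (0 : ℝ)..(Real.pi / 2), g θ = f p.2 - f p.1 := by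
    rw [intervalIntegral.integral_eq_sub_of_hasDerivAt
      (f := fun θ => f (ContinuousLinearMap.rotation θ p).1) (fun θ _ => ?_)
      (hgc.intervalIntegrable _ _)]
    · simp [ContinuousLinearMap.rotation_apply]
    · simp only [hg, inner_gradient_left]
      exact (hf.differentiable _).hasFDerivAt.comp_hasDerivAt θ (hder θ)
  have h1 := sq_intervalIntegral_le hgc hpi
  rw [hftc, intervalIntegral.integral_of_le hpi.le] at h1
  have hint : IntegrableOn (fun θ => g θ ^ 2) (Set.Ioc 0 (Real.pi / 2)) :=
    ((hgc.pow 2).integrableOn_Icc).mono_set Set.Ioc_subset_Icc_self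
  have h2 := ENNReal.ofReal_le_ofReal h1
  rw [ENNReal.ofReal_mul hpi.le, ofReal_integral_eq_lintegral_ofReal hint
    (Filter.Eventually.of_forall fun _ => sq_nonneg _)] at h2
  have hsq : ∀ r : ℝ, ‖r‖ₑ ^ 2 = ENNReal.ofReal (r ^ 2) := fun r => by
    rw [← sq_abs, ENNReal.ofReal_pow (abs_nonneg _), Real.enorm_eq_ofReal_abs]
  rw [hsq]
  refine h2.trans (mul_le_mul_right ?_ _)
  refine lintegral_mono fun θ => ?_
  rw [← hsq, ← mul_pow]
  gcongr
  rw [← ofReal_norm, ← ofReal_norm, ← ofReal_norm, ← ENNReal.ofReal_mul (norm_nonneg _)]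
  exact ENNReal.ofReal_le_ofReal (norm_inner_le_norm _ _)

theorem map_rotation_gamma (n : ℕ) (θ : ℝ) :
    ((γ n).prod (γ n)).map (ContinuousLinearMap.rotation θ) = (γ n).prod (γ n) :=
  IsGaussian.map_rotation_eq_self (by simp) θ

/-- A Poincaré inequality for the Gaussian measure, in the form of a bound on the variance, with a
dimension dependent constant. It follows from the rotation invariance of `γ ⊗ γ`. -/
theorem lintegral_sub_sq_le {n : ℕ} {f : R n → ℝ} (hf : IsFC f) :
    ∫⁻ p, ‖f p.2 - f p.1‖ₑ ^ 2 ∂((γ n).prod (γ n)) ≤ ENNReal.ofReal (Real.pi / 2) ^ 2 *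
      ((∫⁻ x, ‖gradient f x‖ₑ ^ 2 ∂γ n) * ∫⁻ x, ‖x‖ₑ ^ 2 ∂γ n) := by
  have hgrad := continuous_gradient hf
  have hm : Measurable fun q : (R n × R n) × ℝ =>
      ‖gradient f (ContinuousLinearMap.rotation q.2 q.1).1‖ₑ ^ 2 *
          ‖(ContinuousLinearMap.rotation q.2 q.1).2‖ₑ ^ 2 := by
    simp only [ContinuousLinearMap.rotation_apply]
    refine Measurable.mul (Measurable.pow_const (Measurable.enorm ?_) 2)
      (Measurable.pow_const (Measurable.enorm ?_) 2)
    · exact Continuous.measurable (hgrad.comp (by fun_prop))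
    · exact Continuous.measurable (by fun_prop)
  calc ∫⁻ p, ‖f p.2 - f p.1‖ₑ ^ 2 ∂((γ n).prod (γ n))
    _ ≤ ∫⁻ p, (ENNReal.ofReal (Real.pi / 2) * ∫⁻ θ in Set.Ioc 0 (Real.pi / 2),
        ‖gradient f (ContinuousLinearMap.rotation θ p).1‖ₑ ^ 2 *
          ‖(ContinuousLinearMap.rotation θ p).2‖ₑ ^ 2) ∂((γ n).prod (γ n)) :=
      lintegral_mono fun p => enorm_sub_sq_le_lintegral_rotation hf p
    _ = ENNReal.ofReal (Real.pi / 2) * ∫⁻ θ in Set.Ioc 0 (Real.pi / 2), ∫⁻ p,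
        ‖gradient f (ContinuousLinearMap.rotation θ p).1‖ₑ ^ 2 *
          ‖(ContinuousLinearMap.rotation θ p).2‖ₑ ^ 2 ∂((γ n).prod (γ n)) := by
      rw [lintegral_const_mul' _ _ ENNReal.ofReal_ne_top, lintegral_lintegral_swap hm.aemeasurable]
    _ = ENNReal.ofReal (Real.pi / 2) * ∫⁻ θ in Set.Ioc 0 (Real.pi / 2),
        (∫⁻ x, ‖gradient f x‖ₑ ^ 2 ∂γ n) * ∫⁻ x, ‖x‖ₑ ^ 2 ∂γ n := by
      congr 1
      refine lintegral_congr fun θ => ?_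
      have h1 : Measurable fun x : R n => ‖gradient f x‖ₑ ^ 2 := by
        exact (hgrad.measurable.enorm).pow_const 2
      have h2 : Measurable fun x : R n => ‖x‖ₑ ^ 2 := measurable_id.enorm.pow_const 2
      rw [← lintegral_prod_mul h1.aemeasurable h2.aemeasurable]
      conv_rhs => rw [← map_rotation_gamma n θ]
      have h3 : Measurable fun z : R n × R n => ‖gradient f z.1‖ₑ ^ 2 * ‖z.2‖ₑ ^ 2 :=
        (h1.comp measurable_fst).mul (h2.comp measurable_snd)
      rw [lintegral_map h3 (ContinuousLinearMap.continuous _).measurable]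
    _ = _ := by
      rw [lintegral_const, Measure.restrict_apply_univ, Real.volume_Ioc, sub_zero]
      ring


theorem memLp_id_gamma (n : ℕ) : MemLp (id : R n → R n) 2 (γ n) := IsGaussian.memLp_two_id

theorem eLpNorm_two_sq {X F : Type*} [MeasurableSpace X] [NormedAddCommGroup F] (f : X → F)
    (μ : Measure X) : eLpNorm f 2 μ ^ 2 = ∫⁻ x, ‖f x‖ₑ ^ 2 ∂μ := by
  rw [eLpNorm_eq_lintegral_rpow_enorm_toReal (by norm_num) (by norm_num), ← ENNReal.rpow_natCast,
    ← ENNReal.rpow_mul]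
  norm_num

/-- The dual form of the Poincaré inequality: a function of mean zero acts on `f` as a bounded
functional of `∇f`. -/
theorem exists_abs_integral_mul_le (n : ℕ) : ∃ C : ℝ, 0 ≤ C ∧ ∀ b : Lp ℝ 2 (γ n),
    ∫ x, b x ∂γ n = 0 → ∀ f : R n → ℝ, ∀ hf : IsFC f,
      |∫ x, b x * f x ∂γ n| ≤ C * ‖b‖ * ‖hf.memLp_gradient.toLp (gradient f)‖ := by
  refine ⟨Real.pi / 2 * (eLpNorm (id : R n → R n) 2 (γ n)).toReal, by positivity,
    fun b hb f hf => ?_⟩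
  have hbi : Integrable b (γ n) := (Lp.memLp b).integrable (by norm_num)
  have hfi : Integrable f (γ n) := hf.memLp.integrable (by norm_num)
  have hbfi : Integrable (fun x => b x * f x) (γ n) := (Lp.memLp b).integrable_mul hf.memLp
  have i1 : Integrable (fun p : R n × R n => b p.2 * f p.2) ((γ n).prod (γ n)) := by
    simpa using (integrable_const (1 : ℝ)).mul_prod hbfi
  have i2 : Integrable (fun p : R n × R n => b p.2 * f p.1) ((γ n).prod (γ n)) := by
    simpa [mul_comm] using hfi.mul_prod hbi
  -- The extra term `∫∫ b y * f x` vanishes because `b` has mean zero.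
  have key : ∫ x, b x * f x ∂γ n =
      ∫ p : R n × R n, b p.2 * (f p.2 - f p.1) ∂((γ n).prod (γ n)) := by
    simp only [mul_sub]
    rw [integral_sub i1 i2]
    have e1 : ∫ p : R n × R n, b p.2 * f p.2 ∂((γ n).prod (γ n)) = ∫ x, b x * f x ∂γ n := by
      simpa using integral_prod_mul (μ := γ n) (ν := γ n) (fun _ => (1 : ℝ)) fun x => b x * f x
    have e2 : ∫ p : R n × R n, b p.2 * f p.1 ∂((γ n).prod (γ n)) = 0 := by
      have := integral_prod_mul (μ := γ n) (ν := γ n) f b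
      simp only [hb, mul_zero] at this
      simpa only [mul_comm] using this
    rw [e1, e2, sub_zero]
  set d : R n × R n → ℝ := fun p => f p.2 - f p.1 with hd
  have hb2 : eLpNorm (fun p : R n × R n => b p.2) 2 ((γ n).prod (γ n)) = eLpNorm b 2 (γ n) :=
    eLpNorm_comp_measurePreserving (Lp.aestronglyMeasurable b) measurePreserving_snd
  have hdm : AEStronglyMeasurable d ((γ n).prod (γ n)) :=
    ((hf.smooth.continuous.comp continuous_snd).sub
      (hf.smooth.continuous.comp continuous_fst)).aestronglyMeasurable
  have hd2 : eLpNorm d 2 ((γ n).prod (γ n)) ≤ ENNReal.ofReal (Real.pi / 2) *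
      (eLpNorm (gradient f) 2 (γ n) * eLpNorm (id : R n → R n) 2 (γ n)) := by
    rw [← ENNReal.pow_le_pow_left_iff two_ne_zero, mul_pow, mul_pow, eLpNorm_two_sq,
      eLpNorm_two_sq, eLpNorm_two_sq]
    exact lintegral_sub_sq_le hf
  have hle : ‖∫ x, b x * f x ∂γ n‖ₑ ≤ eLpNorm b 2 (γ n) * (ENNReal.ofReal (Real.pi / 2) *
      (eLpNorm (gradient f) 2 (γ n) * eLpNorm (id : R n → R n) 2 (γ n))) := by
    rw [key]
    refine (enorm_integral_le_lintegral_enorm _).trans ?_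
    rw [← eLpNorm_one_eq_lintegral_enorm]
    refine (eLpNorm_smul_le_mul_eLpNorm (p := 2) (q := 2) (r := 1) hdm
      ((Lp.aestronglyMeasurable b).comp_snd)).trans ?_
    rw [hb2]
    gcongr
  rw [← Real.norm_eq_abs, Lp.norm_def, Lp.norm_def, eLpNorm_congr_ae hf.memLp_gradient.coeFn_toLp]
  have := ENNReal.toReal_mono (by
    have h1 := (Lp.memLp b).eLpNorm_ne_top
    have h2 := hf.memLp_gradient.eLpNorm_ne_top
    have h3 := (memLp_id_gamma n).eLpNorm_ne_top
    finiteness) hle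
  simp only [toReal_enorm, ENNReal.toReal_mul,
    ENNReal.toReal_ofReal (show 0 ≤ Real.pi / 2 by positivity)] at this
  linarith

/-- The divergence maps onto the functions of mean zero, with a bound on the preimage. -/
theorem exists_divergence_eq (n : ℕ) : ∃ C : ℝ, 0 ≤ C ∧ ∀ b : Lp ℝ 2 (γ n),
    ∫ x, b x ∂γ n = 0 → ∃ u : Lp (R n) 2 (γ n), (u, b) ∈ (I n).graph ∧ ‖u‖ ≤ C * ‖b‖ := by
  obtain ⟨C, hC, h⟩ := exists_abs_integral_mul_le n
  refine ⟨C, hC, fun b hb => ?_⟩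
  have hbound : ∀ p ∈ derivGraph n, |inner ℝ b p.1| ≤ C * ‖b‖ * ‖p.2‖ := by
    rintro p ⟨f, hf, h1, h2⟩
    have e2 : p.2 = hf.memLp_gradient.toLp (gradient f) :=
      Lp.ext (h2.trans hf.memLp_gradient.coeFn_toLp.symm)
    have e1 : inner ℝ b p.1 = ∫ x, b x * f x ∂γ n := by
      rw [L2.inner_def]
      refine integral_congr_ae ?_
      filter_upwards [h1] with x hx
      simp [hx, mul_comm]
    rw [e1, e2]
    exact h b hb f hf
  -- The functional `∇f ↦ ⟪b, f⟫`, given by its graph.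
  set G : Submodule ℝ (Lp (R n) 2 (γ n) × ℝ) := (derivGraph n).map
    ((LinearMap.snd ℝ (Lp ℝ 2 (γ n)) (Lp (R n) 2 (γ n))).prod
      ((innerSL ℝ b).toLinearMap ∘ₗ LinearMap.fst ℝ (Lp ℝ 2 (γ n)) (Lp (R n) 2 (γ n)))) with hG
  have hGb : ∀ q ∈ G, |q.2| ≤ C * ‖b‖ * ‖q.1‖ := by
    rintro _ ⟨p, hp, rfl⟩
    exact hbound p hp
  have hgraph : G.toLinearPMap.graph = G := Submodule.toLinearPMap_graph_eq G fun q hq h0 => by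
    have := hGb q hq
    rw [h0, norm_zero, mul_zero] at this
    exact abs_nonpos_iff.1 this
  obtain ⟨F, hF, hFn⟩ := _root_.exists_extension_norm_eq G.toLinearPMap.domain
    (G.toLinearPMap.toFun.mkContinuous (C * ‖b‖) fun x => by
      have hx := G.toLinearPMap.mem_graph x
      rw [hgraph] at hx
      exact hGb _ hx)
  refine ⟨(InnerProductSpace.toDual ℝ _).symm F, ?_, ?_⟩
  · rw [mem_I_graph_iff]
    intro f hf
    have hmem : (hf.memLp_gradient.toLp (gradient f), inner ℝ b (hf.memLp.toLp f)) ∈ G :=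
      ⟨_, mem_derivGraph hf, rfl⟩
    rw [← hgraph, LinearPMap.mem_graph_iff] at hmem
    obtain ⟨y, hy1, hy2⟩ := hmem
    have h1 := hF y
    rw [← InnerProductSpace.toDual_symm_apply (𝕜 := ℝ)] at h1
    simp only at hy1 hy2
    rw [hy1] at h1
    have h2 : inner ℝ ((InnerProductSpace.toDual ℝ _).symm F)
        (hf.memLp_gradient.toLp (gradient f)) = inner ℝ b (hf.memLp.toLp f) := h1.trans hy2
    rw [L2.inner_def, L2.inner_def] at h2
    refine Eq.trans (integral_congr_ae ?_) (h2.trans (integral_congr_ae ?_))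
    · filter_upwards [hf.memLp_gradient.coeFn_toLp] with x hx
      rw [hx]
    · filter_upwards [hf.memLp.coeFn_toLp] with x hx
      simp [hx, mul_comm]
  · rw [LinearIsometryEquiv.norm_map, hFn]
    exact LinearMap.mkContinuous_norm_le _ (by positivity) _

/-! ### The Gaussian density and explicit divergences -/

theorem pi_gaussianReal_eq_withDensity (n : ℕ) :
    Measure.pi (fun _ : Fin n => gaussianReal 0 1) =
      (volume : Measure (Fin n → ℝ)).withDensity
        fun x => ENNReal.ofReal (∏ i, gaussianPDFReal 0 1 (x i)) := by
  refine Measure.pi_eq (μ := fun _ : Fin n => gaussianReal 0 1) fun s hs => ?_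
  have hnn : ∀ x : Fin n → ℝ, 0 ≤ ∏ i, gaussianPDFReal 0 1 (x i) := fun x =>
    Finset.prod_nonneg fun i _ => gaussianPDFReal_nonneg _ _ _
  rw [withDensity_apply _ (MeasurableSet.univ_pi hs), volume_pi, Measure.restrict_pi_pi,
    ← ofReal_integral_eq_lintegral_ofReal
      (Integrable.fintype_prod fun i => (integrable_gaussianPDFReal 0 1).restrict)
      (Filter.Eventually.of_forall hnn),
    integral_fintype_prod_eq_prod, ENNReal.ofReal_prod_of_nonneg fun i _ =>
      integral_nonneg fun _ => gaussianPDFReal_nonneg _ _ _]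
  refine Finset.prod_congr rfl fun i _ => ?_
  rw [gaussianReal_apply_eq_integral 0 one_ne_zero]

/-- The density of the standard Gaussian measure with respect to Lebesgue measure. -/
noncomputable def gaussianDensity {n : ℕ} (x : R n) : ℝ := ∏ i, gaussianPDFReal 0 1 (x i)

theorem gaussianDensity_pos {n : ℕ} (x : R n) : 0 < gaussianDensity x :=
  Finset.prod_pos fun _ _ => gaussianPDFReal_pos _ _ _ one_ne_zero

theorem contDiff_gaussianDensity (n : ℕ) : ContDiff ℝ ∞ (gaussianDensity (n := n)) := by
  refine contDiff_prod fun i _ => ?_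
  have : ContDiff ℝ ∞ (gaussianPDFReal 0 1) := by
    unfold gaussianPDFReal
    fun_prop
  exact this.comp (by fun_prop)

theorem gamma_eq_withDensity (n : ℕ) :
    γ n = volume.withDensity fun x => ENNReal.ofReal (gaussianDensity x) := by
  rw [γ, ← map_pi_eq_stdGaussian, pi_gaussianReal_eq_withDensity]
  have hmp := PiLp.volume_preserving_toLp (Fin n)
  ext s hs
  rw [Measure.map_apply hmp.measurable hs, withDensity_apply _ (hmp.measurable hs),
    withDensity_apply _ hs, ← hmp.setLIntegral_comp_preimage hs
      (contDiff_gaussianDensity n).continuous.measurable.ennreal_ofReal]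
  rfl

theorem measurable_ofReal_gaussianDensity (n : ℕ) :
    Measurable fun x : R n => ENNReal.ofReal (gaussianDensity x) :=
  (contDiff_gaussianDensity n).continuous.measurable.ennreal_ofReal

theorem integral_gamma {n : ℕ} {F : Type*} [NormedAddCommGroup F] [NormedSpace ℝ F]
    (g : R n → F) : ∫ x, g x ∂γ n = ∫ x, gaussianDensity x • g x := by
  rw [gamma_eq_withDensity, integral_withDensity_eq_integral_toReal_smul
    (measurable_ofReal_gaussianDensity n) (by simp)]
  simp only [ENNReal.toReal_ofReal (gaussianDensity_pos _).le]

theorem integrable_gamma_iff {n : ℕ} {F : Type*} [NormedAddCommGroup F] [NormedSpace ℝ F]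
    (g : R n → F) : Integrable g (γ n) ↔ Integrable (fun x => gaussianDensity x • g x) := by
  rw [gamma_eq_withDensity, integrable_withDensity_iff_integrable_smul'
    (measurable_ofReal_gaussianDensity n) (by simp)]
  simp only [ENNReal.toReal_ofReal (gaussianDensity_pos _).le]

theorem gamma_absolutelyContinuous (n : ℕ) : γ n ≪ volume := by
  rw [gamma_eq_withDensity]
  exact withDensity_absolutelyContinuous _ _

theorem locallyIntegrable_of_integrable_gamma {n : ℕ} {f : R n → ℝ} (hf : Integrable f (γ n)) :
    LocallyIntegrable f := by
  rw [integrable_gamma_iff] at hf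
  have hc : Continuous fun x : R n => (gaussianDensity x)⁻¹ :=
    (contDiff_gaussianDensity n).continuous.inv₀ fun x => (gaussianDensity_pos x).ne'
  rw [locallyIntegrable_iff]
  intro K hK
  refine (hf.integrableOn (s := K)).continuousOn_smul hc.continuousOn hK |>.congr ?_
  refine Filter.Eventually.of_forall fun x => ?_
  simp [(gaussianDensity_pos x).ne']

theorem memLp_gamma_of_hasCompactSupport {n : ℕ} {F : Type*} [NormedAddCommGroup F]
    {g : R n → F} (hg : Continuous g) (hc : HasCompactSupport g) : MemLp g 2 (γ n) := by
  obtain ⟨C, hC⟩ := hg.bounded_above_of_compact_support hc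
  exact MemLp.of_bound hg.aestronglyMeasurable C
    (Filter.Eventually.of_forall hC)

/-- The vector field `(η / ρ) v`, where `ρ` is the Gaussian density, has divergence
`-∂ᵥη / ρ` with respect to the Gaussian measure. -/
theorem mem_I_graph_of_contDiff {n : ℕ} {η : R n → ℝ} (hη : ContDiff ℝ ∞ η)
    (hc : HasCompactSupport η) (v : R n) :
    ∃ (hu : MemLp (fun x => (gaussianDensity x)⁻¹ • η x • v) 2 (γ n))
      (ha : MemLp (fun x => (gaussianDensity x)⁻¹ • -fderiv ℝ η x v) 2 (γ n)),
      (MemLp.toLp _ hu, MemLp.toLp _ ha) ∈ (I n).graph := by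
  have hρ : Continuous fun x : R n => (gaussianDensity x)⁻¹ :=
    (contDiff_gaussianDensity n).continuous.inv₀ fun x => (gaussianDensity_pos x).ne'
  have hd : Continuous fun x => fderiv ℝ η x v :=
    (hη.continuous_fderiv (by simp)).clm_apply continuous_const
  have hcd : HasCompactSupport fun x => fderiv ℝ η x v := hc.fderiv_apply ℝ v
  have hηv : Continuous fun x => (gaussianDensity x)⁻¹ • η x • v :=
    hρ.smul (hη.continuous.smul continuous_const)
  have hηvc : HasCompactSupport fun x => (gaussianDensity x)⁻¹ • η x • v :=
    hc.mono fun x hx h0 => hx (by simp [h0])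
  have hdc : Continuous fun x => (gaussianDensity x)⁻¹ • -fderiv ℝ η x v := hρ.smul hd.neg
  have hdcc : HasCompactSupport fun x => (gaussianDensity x)⁻¹ • -fderiv ℝ η x v :=
    hcd.mono fun x hx h0 => hx (by simp [show fderiv ℝ η x v = 0 from h0])
  have hu := memLp_gamma_of_hasCompactSupport hηv hηvc
  have ha := memLp_gamma_of_hasCompactSupport hdc hdcc
  refine ⟨hu, ha, (mem_I_graph_iff n _ _).2 fun f hf => ?_⟩
  have hfc := hf.smooth.continuous
  have hfd : Continuous fun x => fderiv ℝ f x v :=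
    (hf.smooth.continuous_fderiv (by simp)).clm_apply continuous_const
  have e1 : ∫ x, inner ℝ (MemLp.toLp _ hu x) (gradient f x) ∂γ n = ∫ x, η x * fderiv ℝ f x v := by
    rw [integral_congr_ae (g := fun x => (gaussianDensity x)⁻¹ • (η x * fderiv ℝ f x v)),
      integral_gamma]
    · simp [(gaussianDensity_pos _).ne']
    · filter_upwards [hu.coeFn_toLp] with x hx
      rw [hx, real_inner_smul_left, real_inner_smul_left, real_inner_comm, inner_gradient_left,
        smul_eq_mul]
  have e2 : ∫ x, MemLp.toLp _ ha x * f x ∂γ n = - ∫ x, fderiv ℝ η x v * f x := by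
    rw [integral_congr_ae (g := fun x => (gaussianDensity x)⁻¹ • -(fderiv ℝ η x v * f x)),
      integral_gamma, ← integral_neg]
    · simp [(gaussianDensity_pos _).ne']
    · filter_upwards [ha.coeFn_toLp] with x hx
      rw [hx, smul_eq_mul, smul_eq_mul, mul_assoc, neg_mul]
  rw [e1, e2]
  exact integral_mul_fderiv_eq_neg_fderiv_mul_of_integrable
    ((hd.mul hfc).integrable_of_hasCompactSupport hcd.mul_right)
    ((hη.continuous.mul hfd).integrable_of_hasCompactSupport hc.mul_right)
    ((hη.continuous.mul hfc).integrable_of_hasCompactSupport hc.mul_right)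
    (fun x _ => hη.differentiable (by simp) x) (fun x _ => hf.differentiable x)

/-! ### Lipschitz regularity of dual functions and the minimal flux -/

/-- The derivative of a mollification, as the integral against `f` that appears in the divergence of
the field with profile `y ↦ φ (x - y)`. -/
theorem fderiv_normed_convolution_apply {n : ℕ} (φ : ContDiffBump (0 : R n)) {f : R n → ℝ}
    (hf : LocallyIntegrable f) (x v : R n) :
    fderiv ℝ (φ.normed volume ⋆[ContinuousLinearMap.lsmul ℝ ℝ, volume] f) x v =
      ∫ y, -fderiv ℝ (fun y => φ.normed volume (x - y)) y v * f y := by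
  have hφ : ContDiff ℝ 1 (φ.normed volume) := φ.contDiff_normed
  have hL := φ.hasCompactSupport_normed.hasFDerivAt_convolution_left
    (ContinuousLinearMap.lsmul ℝ ℝ) hφ hf x
  rw [hL.fderiv, convolution_eq_swap, ContinuousLinearMap.integral_apply]
  · refine integral_congr_ae (Filter.Eventually.of_forall fun y => ?_)
    have : fderiv ℝ (fun y => φ.normed volume (x - y)) y = -fderiv ℝ (φ.normed volume) (x - y) := by
      have h1 := ((hφ.differentiable one_ne_zero (x - y)).hasFDerivAt).comp y
        ((hasFDerivAt_id y).const_sub x)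
      rw [show (fun y => φ.normed volume (x - y)) = φ.normed volume ∘ HSub.hSub x from rfl,
        h1.fderiv]
      ext w
      simp
    simp [this, ContinuousLinearMap.precompL_apply]
  · have hex : ConvolutionExists (fderiv ℝ (φ.normed volume)) f
        (ContinuousLinearMap.precompL (R n) (ContinuousLinearMap.lsmul ℝ ℝ : ℝ →L[ℝ] ℝ →L[ℝ] ℝ))
        volume :=
      HasCompactSupport.convolutionExists_left _ (φ.hasCompactSupport_normed.fderiv ℝ)
        (hφ.continuous_fderiv one_ne_zero) hf
    exact (hex x).integrable_swap

/-- A function whose pairing with every divergence `I u` is at most `‖u‖₁` has a `1`-Lipschitz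
version: its mollifications have gradient of norm at most `1`, as one sees by testing with the
fields `(η / ρ) v`. -/
theorem exists_lipschitzWith_ae_eq {n : ℕ} (f : Lp ℝ 2 (γ n))
    (h : ∀ u a, (u, a) ∈ (I n).graph → ∫ x, a x * f x ∂γ n ≤ ∫ x, ‖u x‖ ∂γ n) :
    ∃ F : R n → ℝ, LipschitzWith 1 F ∧ f =ᵐ[γ n] F := by
  have hf : LocallyIntegrable f :=
    locallyIntegrable_of_integrable_gamma ((Lp.memLp f).integrable (by norm_num))
  -- The field `(η / ρ) v` with `η y = φ (x - y)` has `L¹(γ)` norm `‖v‖`.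
  have hgrad : ∀ (φ : ContDiffBump (0 : R n)) (x v : R n),
      fderiv ℝ (φ.normed volume ⋆[ContinuousLinearMap.lsmul ℝ ℝ, volume] f) x v ≤ ‖v‖ := by
    intro φ x v
    have hη : ContDiff ℝ ∞ fun y => φ.normed volume (x - y) :=
      φ.contDiff_normed.comp (contDiff_const.sub contDiff_id)
    have hc : HasCompactSupport fun y => φ.normed volume (x - y) :=
      φ.hasCompactSupport_normed.comp_homeomorph (Homeomorph.subLeft x)
    obtain ⟨hu, ha, hgr⟩ := mem_I_graph_of_contDiff hη hc v
    have h1 := h _ _ hgr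
    have e1 : ∫ y, MemLp.toLp _ ha y * f y ∂γ n =
        ∫ y, -fderiv ℝ (fun y => φ.normed volume (x - y)) y v * f y := by
      rw [integral_congr_ae (g := fun y => (gaussianDensity y)⁻¹ •
        (-fderiv ℝ (fun y => φ.normed volume (x - y)) y v * f y)), integral_gamma]
      · simp [(gaussianDensity_pos _).ne']
      · filter_upwards [ha.coeFn_toLp] with y hy
        rw [hy, smul_eq_mul, smul_eq_mul, mul_assoc]
    have e2 : ∫ y, ‖MemLp.toLp _ hu y‖ ∂γ n = ‖v‖ := by
      rw [integral_congr_ae (g := fun y => (gaussianDensity y)⁻¹ •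
        (φ.normed volume (x - y) * ‖v‖)), integral_gamma]
      · simp only [smul_smul, mul_inv_cancel₀ (gaussianDensity_pos _).ne', one_smul]
        rw [integral_mul_const, integral_sub_left_eq_self (fun y => φ.normed volume y),
          φ.integral_normed, one_mul]
      · filter_upwards [hu.coeFn_toLp] with y hy
        rw [hy, norm_smul, norm_smul, Real.norm_of_nonneg (φ.nonneg_normed _),
          Real.norm_of_nonneg (inv_nonneg.2 (gaussianDensity_pos _).le), smul_eq_mul]
    rw [e1, e2] at h1
    rwa [fderiv_normed_convolution_apply φ hf]
  have hlip : ∀ φ : ContDiffBump (0 : R n),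
      LipschitzWith 1 (φ.normed volume ⋆[ContinuousLinearMap.lsmul ℝ ℝ, volume] f) := by
    intro φ
    have hd : ContDiff ℝ 1 (φ.normed volume ⋆[ContinuousLinearMap.lsmul ℝ ℝ, volume] f) :=
      φ.hasCompactSupport_normed.contDiff_convolution_left _ φ.contDiff_normed hf
    refine lipschitzWith_of_nnnorm_fderiv_le (hd.differentiable one_ne_zero) fun x => ?_
    rw [← NNReal.coe_le_coe, coe_nnnorm, NNReal.coe_one]
    refine ContinuousLinearMap.opNorm_le_bound _ zero_le_one fun v => ?_
    rw [one_mul, Real.norm_eq_abs]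
    refine abs_le.2 ⟨?_, hgrad φ x v⟩
    have := hgrad φ x (-v)
    rw [map_neg, norm_neg] at this
    linarith
  set φ : ℕ → ContDiffBump (0 : R n) := fun k => bumpOfRadius (Nat.one_div_pos_of_nat (n := k))
  have hlim := ContDiffBump.ae_convolution_tendsto_right_of_locallyIntegrable (φ := φ) (K := 2)
    (tendsto_one_div_add_atTop_nhds_zero_nat (𝕜 := ℝ))
    (Filter.Eventually.of_forall fun k => by simp [φ, bumpOfRadius]; linarith) hf
  have hon : LipschitzOnWith 1 f {x | Filter.Tendsto (fun k => ((φ k).normed volume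
      ⋆[ContinuousLinearMap.lsmul ℝ ℝ, volume] f) x) Filter.atTop (nhds (f x))} := by
    refine LipschitzOnWith.of_dist_le_mul fun x hx y hy => ?_
    exact le_of_tendsto' (hx.dist hy) fun k => (hlip (φ k)).dist_le_mul x y
  obtain ⟨F, hF, hEq⟩ := hon.extend_real
  refine ⟨F, hF, ?_⟩
  filter_upwards [(gamma_absolutelyContinuous n).ae_le hlim] with x hx
  exact hEq hx

theorem integral_norm_le_norm {n : ℕ} {F : Type*} [NormedAddCommGroup F] (u : Lp F 2 (γ n)) :
    ∫ x, ‖u x‖ ∂γ n ≤ ‖u‖ := by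
  rw [integral_norm_eq_lintegral_enorm (Lp.aestronglyMeasurable u),
    ← eLpNorm_one_eq_lintegral_enorm, Lp.norm_def]
  exact ENNReal.toReal_mono (Lp.memLp u).eLpNorm_ne_top
    (eLpNorm_le_eLpNorm_of_exponent_le (by norm_num) (Lp.aestronglyMeasurable u))

theorem integral_norm_smul_Lp {n : ℕ} (c : ℝ) (u : Lp (R n) 2 (γ n)) :
    ∫ x, ‖(c • u : Lp (R n) 2 (γ n)) x‖ ∂γ n = |c| * ∫ x, ‖u x‖ ∂γ n := by
  rw [← integral_const_mul]
  refine integral_congr_ae ?_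
  filter_upwards [Lp.coeFn_smul c u] with x hx
  rw [hx, Pi.smul_apply, norm_smul, Real.norm_eq_abs]

theorem integral_norm_add_le_Lp {n : ℕ} (u v : Lp (R n) 2 (γ n)) :
    ∫ x, ‖(u + v : Lp (R n) 2 (γ n)) x‖ ∂γ n ≤ ∫ x, ‖u x‖ ∂γ n + ∫ x, ‖v x‖ ∂γ n := by
  rw [← integral_add (integrable_norm_Lp u) (integrable_norm_Lp v)]
  refine integral_mono_ae (integrable_norm_Lp _)
    ((integrable_norm_Lp u).add (integrable_norm_Lp v)) ?_
  filter_upwards [Lp.coeFn_add u v] with x hx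
  rw [hx]
  exact norm_add_le _ _

theorem isFC_const {n : ℕ} (c : ℝ) : IsFC fun _ : R n => c := by
  refine ⟨contDiff_const, fun k => ?_⟩
  cases k with
  | zero => exact ⟨‖c‖, fun x => by simp⟩
  | succ k => exact ⟨0, fun x => by simp [iteratedFDeriv_succ_const]⟩

theorem integral_eq_zero_of_mem_I_graph {n : ℕ} {u : Lp (R n) 2 (γ n)} {a : Lp ℝ 2 (γ n)}
    (h : (u, a) ∈ (I n).graph) : ∫ x, a x ∂γ n = 0 := by
  have := (mem_I_graph_iff n u a).1 h _ (isFC_const 1)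
  simpa using this.symm

/-- The constant functions in `L²(γ)`. -/
noncomputable def constLp (n : ℕ) (t : ℝ) : Lp ℝ 2 (γ n) := (memLp_const t).toLp fun _ => t

theorem coeFn_constLp (n : ℕ) (t : ℝ) : constLp n t =ᵐ[γ n] fun _ => t := MemLp.coeFn_toLp _

/-- The functions which differ by a constant from the divergence of a field `u` with
`‖u‖₁ < c`. The constants make this set a neighbourhood of each of its points in `L²(γ)`. -/
def divergenceBall (n : ℕ) (c : ℝ) : Set (Lp ℝ 2 (γ n)) :=
  {z | ∃ u a t, (u, a) ∈ (I n).graph ∧ ∫ x, ‖u x‖ ∂γ n < c ∧ z = a + constLp n t}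

theorem convex_divergenceBall (n : ℕ) (c : ℝ) : Convex ℝ (divergenceBall n c) := by
  rintro _ ⟨u, a, t, hu, huc, rfl⟩ _ ⟨u', a', t', hu', huc', rfl⟩ r s hr hs hrs
  refine ⟨r • u + s • u', r • a + s • a', r * t + s * t',
    (I n).graph.add_mem ((I n).graph.smul_mem r hu) ((I n).graph.smul_mem s hu'), ?_, ?_⟩
  · refine (integral_norm_add_le_Lp _ _).trans_lt ?_
    rw [integral_norm_smul_Lp, integral_norm_smul_Lp, abs_of_nonneg hr, abs_of_nonneg hs]
    exact convex_Iio c huc huc' hr hs hrs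
  · have : constLp n (r * t + s * t') = r • constLp n t + s • constLp n t' := rfl
    rw [this]
    module

theorem isOpen_divergenceBall (n : ℕ) (c : ℝ) : IsOpen (divergenceBall n c) := by
  obtain ⟨C, hC, hsurj⟩ := exists_divergence_eq n
  rw [Metric.isOpen_iff]
  rintro _ ⟨u, a, t, hu, huc, rfl⟩
  set N := ∫ x, ‖u x‖ ∂γ n with hN
  refine ⟨(c - N) / (2 * C + 1), div_pos (sub_pos.2 huc) (by positivity), fun z hz => ?_⟩
  -- The perturbation `d` is its mean, absorbed in the constant, plus a divergence.
  set d := z - (a + constLp n t) with hd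
  have hdn : ‖d‖ * (2 * C + 1) < c - N := by
    rw [Metric.mem_ball, dist_eq_norm] at hz
    exact (lt_div_iff₀ (by positivity)).1 hz
  set m := ∫ x, d x ∂γ n with hm
  have hdi : Integrable d (γ n) := (Lp.memLp d).integrable (by norm_num)
  have hcm : ‖constLp n m‖ ≤ ‖d‖ := by
    have h1 : ‖constLp n m‖ ≤ |m| := by
      rw [constLp, Lp.norm_toLp]
      rw [eLpNorm_const _ two_ne_zero (IsProbabilityMeasure.ne_zero _)]
      simp
    refine h1.trans ?_
    rw [← Real.norm_eq_abs]
    exact (norm_integral_le_integral_norm _).trans (integral_norm_le_norm d)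
  have hmean : ∫ x, (d - constLp n m : Lp ℝ 2 (γ n)) x ∂γ n = 0 := by
    rw [integral_congr_ae (g := fun x => d x - m), integral_sub hdi (integrable_const m)]
    · simp [hm]
    · filter_upwards [Lp.coeFn_sub d (constLp n m), coeFn_constLp n m] with x h1 h2
      rw [h1, Pi.sub_apply, h2]
  obtain ⟨w, hw, hwn⟩ := hsurj _ hmean
  refine ⟨u + w, a + (d - constLp n m), t + m, (I n).graph.add_mem hu hw, ?_, ?_⟩
  · have h1 : ‖d - constLp n m‖ ≤ 2 * ‖d‖ := (norm_sub_le _ _).trans (by linarith)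
    have h2 : C * ‖d - constLp n m‖ ≤ C * (2 * ‖d‖) := mul_le_mul_of_nonneg_left h1 hC
    have h3 := integral_norm_add_le_Lp u w
    have h4 := integral_norm_le_norm w
    nlinarith [norm_nonneg d]
  · have : constLp n (t + m) = constLp n t + constLp n m := rfl
    rw [this, hd]
    abel

/-- Duality for the minimal flux: if `b` integrates to at most `w` against every `1`-Lipschitz
function, then it is the divergence of fields whose `L¹` norms are as close to `w` as desired. -/
theorem exists_divergence_eq_of_lipschitz_bound {n : ℕ} {b : Lp ℝ 2 (γ n)}
    (hb : ∫ x, b x ∂γ n = 0) {w c : ℝ} (hwc : w < c)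
    (hw : ∀ F : R n → ℝ, LipschitzWith 1 F → MemLp F 2 (γ n) → ∫ x, b x * F x ∂γ n ≤ w) :
    ∃ u, (u, b) ∈ (I n).graph ∧ ∫ x, ‖u x‖ ∂γ n < c := by
  have hc : 0 < c := by
    have := hw (fun _ => 0) (LipschitzWith.const' 0) (memLp_const 0)
    simp only [mul_zero, integral_zero] at this
    linarith
  by_cases hmem : b ∈ divergenceBall n c
  · obtain ⟨u, a, t, hu, huc, hbt⟩ := hmem
    have ht : t = 0 := by
      have hai : Integrable a (γ n) := (Lp.memLp a).integrable (by norm_num)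
      rw [hbt, integral_congr_ae (g := fun x => a x + t), integral_add hai (integrable_const t),
        integral_eq_zero_of_mem_I_graph hu] at hb
      · simpa using hb
      · filter_upwards [Lp.coeFn_add a (constLp n t), coeFn_constLp n t] with x h1 h2
        rw [h1, Pi.add_apply, h2]
    refine ⟨u, ?_, huc⟩
    rwa [hbt, ht, show constLp n 0 = 0 from rfl, add_zero]
  exfalso
  obtain ⟨l, hl⟩ := geometric_hahn_banach_open_point (convex_divergenceBall n c)
    (isOpen_divergenceBall n c) hmem
  have hball : ∀ u a, (u, a) ∈ (I n).graph → ∫ x, ‖u x‖ ∂γ n < c → l a < l b :=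
    fun u a hu huc => hl a ⟨u, a, 0, hu, huc, by
      rw [show constLp n 0 = 0 from rfl, add_zero]⟩
  have hlb : 0 < l b := by
    have := hball 0 0 (I n).graph.zero_mem (by
      refine (integral_norm_le_norm 0).trans_lt ?_
      rwa [norm_zero])
    simpa using this
  -- Rescaling `u` so that `‖u‖₁` is just below `c` turns the separation into a linear bound.
  have hscale : ∀ u a, (u, a) ∈ (I n).graph → c / l b * l a ≤ ∫ x, ‖u x‖ ∂γ n := by
    intro u a hu
    refine le_of_forall_pos_le_add fun δ hδ => ?_
    set N := ∫ x, ‖u x‖ ∂γ n with hN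
    have hN0 : 0 ≤ N := integral_nonneg fun _ => norm_nonneg _
    have h1 := hball _ _ ((I n).graph.smul_mem (c / (N + δ)) hu) (by
      rw [integral_norm_smul_Lp, abs_of_pos (by positivity), ← hN, div_mul_eq_mul_div,
        div_lt_iff₀ (by positivity)]
      nlinarith)
    rw [map_smul, smul_eq_mul, div_mul_eq_mul_div, div_lt_iff₀ (by positivity)] at h1
    rw [div_mul_eq_mul_div, div_le_iff₀ hlb]
    linarith
  set f : Lp ℝ 2 (γ n) := (c / l b) • (InnerProductSpace.toDual ℝ _).symm l with hf
  have hfl : ∀ a : Lp ℝ 2 (γ n), ∫ x, a x * f x ∂γ n = c / l b * l a := by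
    intro a
    have h1 : inner ℝ f a = c / l b * l a := by
      rw [hf, real_inner_smul_left, InnerProductSpace.toDual_symm_apply]
    rw [← h1, L2.inner_def]
    rfl
  obtain ⟨F, hF, hfF⟩ := exists_lipschitzWith_ae_eq f fun u a hu => by
    rw [hfl]
    exact hscale u a hu
  have h1 := hw F hF ((memLp_congr_ae hfF).1 (Lp.memLp f))
  rw [integral_congr_ae (g := fun x => b x * f x)
    (by filter_upwards [hfF] with x hx; rw [hx]), hfl, div_mul_cancel₀ _ hlb.ne'] at h1
  linarith

end GaussianKR

theorem lemma2 (n : ℕ) (ν₀ ν₁ : Measure (EuclideanSpace ℝ (Fin n)))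
    [IsProbabilityMeasure ν₀] [IsProbabilityMeasure ν₁]
    (hac : (ν₁.toSignedMeasure - ν₀.toSignedMeasure) ≪ᵥ
      (stdGaussian (EuclideanSpace ℝ (Fin n))).toENNRealVectorMeasure)
    (hα : MemLp
      ((ν₁.toSignedMeasure - ν₀.toSignedMeasure).rnDeriv (stdGaussian (EuclideanSpace ℝ (Fin n))))
      2 (stdGaussian (EuclideanSpace ℝ (Fin n)))) :
    GaussianKR.W₁ ν₀ ν₁ =
      ⨅ (u : (GaussianKR.I n).domain) (_ : GaussianKR.I n u = hα.toLp),
        ∫⁻ x, ‖(u : Lp (EuclideanSpace ℝ (Fin n)) 2 (stdGaussian (EuclideanSpace ℝ (Fin n)))) x‖ₑ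
          ∂(stdGaussian (EuclideanSpace ℝ (Fin n))) := by
  have hdens := SignedMeasure.withDensityᵥ_rnDeriv_eq _ _ hac
  have hαm := SignedMeasure.measurable_rnDeriv (ν₁.toSignedMeasure - ν₀.toSignedMeasure)
    (stdGaussian (EuclideanSpace ℝ (Fin n)))
  have hαi : Integrable _ _ := hα.integrable (by norm_num)
  have hpair : ∀ f : EuclideanSpace ℝ (Fin n) → ℝ,
      ∫ x, MemLp.toLp _ hα x * f x ∂(stdGaussian (EuclideanSpace ℝ (Fin n))) =
        ∫ x, (ν₁.toSignedMeasure - ν₀.toSignedMeasure).rnDeriv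
          (stdGaussian (EuclideanSpace ℝ (Fin n))) x * f x
            ∂(stdGaussian (EuclideanSpace ℝ (Fin n))) := by
    intro f
    refine integral_congr_ae ?_
    filter_upwards [hα.coeFn_toLp] with x hx
    rw [hx]
  have hnorm : ∀ u : Lp (GaussianKR.R n) 2 (GaussianKR.γ n),
      ENNReal.ofReal (∫ x, ‖u x‖ ∂GaussianKR.γ n) = ∫⁻ x, ‖u x‖ₑ ∂GaussianKR.γ n := fun u =>
    ofReal_integral_norm_eq_lintegral_enorm ((Lp.memLp u).integrable (by norm_num))
  refine le_antisymm (le_iInf₂ fun u hu => ?_) (le_of_not_gt fun hlt => ?_)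
  · rw [← hnorm]
    refine GaussianKR.W₁_le_of_density (GaussianKR.memLp_id_gamma n) hαm hα hdens _
      fun f hf hf2 => ?_
    rw [← hpair]
    refine GaussianKR.integral_mul_le_integral_norm ?_ hf hf2
    rw [← hu]
    exact (GaussianKR.I n).mem_graph u
  · obtain ⟨c, hWc, hc⟩ := ENNReal.lt_iff_exists_nnreal_btwn.1 hlt
    have hW : GaussianKR.W₁ ν₀ ν₁ ≠ ⊤ := (hWc.trans_le le_top).ne
    have hmean : ∫ x, MemLp.toLp _ hα x ∂(GaussianKR.γ n) = 0 := by
      rw [integral_congr_ae hα.coeFn_toLp, ← setIntegral_univ,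
        ← withDensityᵥ_apply hαi MeasurableSet.univ, hdens]
      simp [Measure.toSignedMeasure_apply_measurable MeasurableSet.univ]
    obtain ⟨u, hu, huc⟩ := GaussianKR.exists_divergence_eq_of_lipschitz_bound hmean
      (w := (GaussianKR.W₁ ν₀ ν₁).toReal) (c := c)
      (by rwa [← ENNReal.toReal_lt_toReal hW ENNReal.coe_ne_top] at hWc) fun F hF hF2 => by
        rw [hpair, ← ENNReal.ofReal_le_iff_le_toReal hW]
        exact GaussianKR.ofReal_integral_mul_le_W₁ hαm hαi hdens hF (hα.integrable_mul hF2)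
    obtain ⟨y, hy1, hy2⟩ := (LinearPMap.mem_graph_iff _).1 hu
    refine absurd (hc.trans_le (iInf₂_le y hy2)) (not_lt_of_ge ?_)
    rw [← hnorm, hy1]
    exact (ENNReal.ofReal_le_ofReal huc.le).trans (by simp)
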